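/- Let $k\ge 1$ be an integer, put $N(k)=4k(4k+1)$, and let $X_{1,t},X_{2,t},Y_t$ ($1\le t\le 4k-1$) be indeterminates. Empty products are $1$, and $(\alpha)_m:=\alpha(\alpha+1)\cdots(\alpha+m-1)$, $(\alpha)_0:=1$. Define $$f_0(t,j)=\big((N(k)+j)Y_t-X_{2,t}\big)(-4)^k,\qquad f_1(t,j)=-\big((4N(k)+4j+2)Y_t-4X_{1,t}\big)(-4)^k,$$ $$g_0(t,j)=X_{2,t}-jY_t,\qquad g_1(t,j)=-\big(4X_{1,t}-(4j+2)Y_t\big).$$ For $1\le\ell\le 4k$ let $x_\ell$ be the row vector with $4k$ entries, all zero except the last, which is $$(-1)^{\ell-1}(-4)^{(\ell+1)k}\,8k(4k+1)\prod_{i=1}^{4k-\ell}(4ik-1)\prod_{i=1}^{\ell-1}(4ik+1),$$ let $F^X_\ell$ be the $(4k-1)\times 4k$ matrix whose only nonzero entries are $f_1(t,4(\ell-1)k+t)$ in position $(t,t)$ and $f_0(t,4(\ell-1)k+t+1)$ in position $(t,t+1)$, $1\le t\le 4k-1$, and let $G^X_\ell$ be defined in the same way with $g_1,g_0$ in place of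 $f_1,f_0$. Let $M^X$ be the $16k^2\times16k^2$ matrix with top row $(x_1,x_2,\dots,x_{4k})$, below which there are $4k+1$ block rows of $4k-1$ rows each: in the $\ell$-th block column ($1\le\ell\le4k$) the block row $\ell$ is $F^X_\ell$, the block row $\ell+1$ is $G^X_\ell$, and all other block rows are $0$. Then $$\begin{aligned}\det M^X={}&(-1)^{k-1}\,4^{2k(4k^2+7k+2)}\,k^{2k(4k+1)}\prod_{i=1}^{4k}(i+1)_{4k-i+1}\\ &\times\prod_{a=1}^{4k-1}\big(2X_{1,a}-(32k^2+2a-1)Y_a\big)\\ &\times\prod_{1\le a\le b\le 4k-1}\big(2X_{2,b}Y_a-2X_{1,a}Y_b-(2b-2a+1)Y_aY_b\big).\end{aligned}$$ Moreover, the specialisation of $M^X$ at $X_{1,t}=X_{2,t}=N(k)$, $Y_t=1$ has nonzero determinant, and the following rational square matrix $M$ of size $N(k)+4k+1$ is nonsingular. Label its rows by $0,1,\dots,N(k)+4k$ and its columns by $1,\dots,N(k)+4k+1$. Row $0$ is $(0,\dots,0,y_0,y_1,\dots,y_{4k+1})$, starting with $N(k)-1$ zeros, where $y_0=\prod_{i=1}^{4k+1}(4ik-1)$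 and $y_\ell=(-1)^\ell\prod_{i=1}^{4k+1-\ell}(4ik-1)\prod_{i=1}^{\ell-1}(4ik+1)$ for $1\le\ell\le4k+1$. For $1\le j\le N(k)-1$, the only nonzero entries of column $j$ are $j(-4)^k$, $-(4j+2)(-4)^k$, $N(k)-j$ and $-(4N(k)-4j-2)$, in rows $j$, $j+1$, $j+4k$ and $j+4k+1$ respectively. For $0\le j\le4k+1$, column $N(k)+j$ has, apart from its entry $y_j$ in row $0$, the single nonzero entry $(-4)^{-jk}$ in row $4jk+1$. -/

import Mathlib

namespace PiSeries

open Finset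

/-- `N(k) = 4k(4k+1)`. -/
def N (k : ℕ) : ℕ := 4 * k * (4 * k + 1)

section Generic

/-! The matrix `M^X` with the indeterminates `X_{1,t}`, `X_{2,t}`, `Y_t` replaced by elements
`X₁ t`, `X₂ t`, `Y t` of a commutative ring `R`.  Only `1 ≤ t ≤ 4k - 1` is ever used. -/

variable {R : Type*} [CommRing R]

/-- `f₀(t,j) = ((N(k)+j) Y_t - X_{2,t}) (-4)^k`. -/
def f₀ (k : ℕ) (X₂ Y : ℕ → R) (t j : ℕ) : R :=
  (((N k : R) + (j : R)) * Y t - X₂ t) * (-4) ^ k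

/-- `f₁(t,j) = -((4N(k)+4j+2) Y_t - 4 X_{1,t}) (-4)^k`. -/
def f₁ (k : ℕ) (X₁ Y : ℕ → R) (t j : ℕ) : R :=
  -((4 * (N k : R) + 4 * (j : R) + 2) * Y t - 4 * X₁ t) * (-4) ^ k

/-- `g₀(t,j) = X_{2,t} - j Y_t`. -/
def g₀ (X₂ Y : ℕ → R) (t j : ℕ) : R :=
  X₂ t - (j : R) * Y t

/-- `g₁(t,j) = -(4 X_{1,t} - (4j+2) Y_t)`. -/
def g₁ (X₁ Y : ℕ → R) (t j : ℕ) : R :=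
  -(4 * X₁ t - (4 * (j : R) + 2) * Y t)

/-- The `s`-th entry (`1 ≤ s ≤ 4k`) of the row vector `x_ℓ` (`1 ≤ ℓ ≤ 4k`): only the last entry
is nonzero. -/
def x (R : Type*) [CommRing R] (k ℓ s : ℕ) : R :=
  if s = 4 * k then
    (-1) ^ (ℓ - 1) * (-4) ^ ((ℓ + 1) * k) * (8 * (k : R) * (4 * (k : R) + 1))
      * (∏ i ∈ Icc 1 (4 * k - ℓ), (4 * (i : R) * (k : R) - 1))
      * (∏ i ∈ Icc 1 (ℓ - 1), (4 * (i : R) * (k : R) + 1))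
  else 0

/-- The `(t,s)`-entry (`1 ≤ t ≤ 4k-1`, `1 ≤ s ≤ 4k`) of the block `F^X_ℓ`. -/
def F (k : ℕ) (X₁ X₂ Y : ℕ → R) (ℓ t s : ℕ) : R :=
  if s = t then f₁ k X₁ Y t (4 * (ℓ - 1) * k + t)
  else if s = t + 1 then f₀ k X₂ Y t (4 * (ℓ - 1) * k + t + 1)
  else 0

/-- The `(t,s)`-entry (`1 ≤ t ≤ 4k-1`, `1 ≤ s ≤ 4k`) of the block `G^X_ℓ`. -/
def G (k : ℕ) (X₁ X₂ Y : ℕ → R) (ℓ t s : ℕ) : R :=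
  if s = t then g₁ X₁ Y t (4 * (ℓ - 1) * k + t)
  else if s = t + 1 then g₀ X₂ Y t (4 * (ℓ - 1) * k + t + 1)
  else 0

/-- The `16k² × 16k²` block matrix.  The topmost row (row `0`) is `(x_1, …, x_{4k})`; below it are
`4k + 1` block rows of `4k - 1` rows each, and there are `4k` block columns of `4k` columns each.
The `ℓ`-th block column (`1 ≤ ℓ ≤ 4k`) has `F^X_ℓ` in block row `ℓ`, `G^X_ℓ` in block row `ℓ + 1`
and zeros in all other block rows. -/
def MXof (k : ℕ) (X₁ X₂ Y : ℕ → R) : Matrix (Fin (16 * k ^ 2)) (Fin (16 * k ^ 2)) R :=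
  fun r c =>
    -- block column `ℓ` and position `s` in it, both counted from 1
    let ℓ := (c : ℕ) / (4 * k) + 1
    let s := (c : ℕ) % (4 * k) + 1
    if (r : ℕ) = 0 then x R k ℓ s
    else
      -- block row `p` and position `t` in it, both counted from 1
      let p := ((r : ℕ) - 1) / (4 * k - 1) + 1
      let t := ((r : ℕ) - 1) % (4 * k - 1) + 1
      if p = ℓ then F k X₁ X₂ Y ℓ t s
      else if p = ℓ + 1 then G k X₁ X₂ Y ℓ t s
      else 0

end Generic

/-- Names of the indeterminates `X_{1,t}`, `X_{2,t}`, `Y_t`. -/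
inductive Var : Type
  | X₁ (t : ℕ)
  | X₂ (t : ℕ)
  | Y (t : ℕ)

noncomputable section

/-- The indeterminate `X_{1,t}`. -/
def X₁ (t : ℕ) : MvPolynomial Var ℤ := MvPolynomial.X (Var.X₁ t)

/-- The indeterminate `X_{2,t}`. -/
def X₂ (t : ℕ) : MvPolynomial Var ℤ := MvPolynomial.X (Var.X₂ t)

/-- The indeterminate `Y_t`. -/
def Y (t : ℕ) : MvPolynomial Var ℤ := MvPolynomial.X (Var.Y t)

/-- The matrix `M^X`, over the polynomial ring in the indeterminates. -/
def MX (k : ℕ) : Matrix (Fin (16 * k ^ 2)) (Fin (16 * k ^ 2)) (MvPolynomial Var ℤ) :=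
  MXof k X₁ X₂ Y

end

/-- The specialisation `X_{1,t} = X_{2,t} = N(k)`, `Y_t = 1`. -/
def special (k : ℕ) : Var → ℤ
  | Var.X₁ _ => (N k : ℤ)
  | Var.X₂ _ => (N k : ℤ)
  | Var.Y _ => 1

/-- The coefficients `y_0, …, y_{4k+1}` in the topmost row of `M` (for `ℓ = 0` the sign is `1` and
the second product is empty). -/
def y (k ℓ : ℕ) : ℚ :=
  (-1) ^ ℓ * (∏ i ∈ Icc 1 (4 * k + 1 - ℓ), (4 * (i : ℚ) * (k : ℚ) - 1))
    * (∏ i ∈ Icc 1 (ℓ - 1), (4 * (i : ℚ) * (k : ℚ) + 1))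

/-- The coefficient matrix `M` of the system of linear equations.  Its rows are labelled
`0, …, N(k) + 4k` and its columns `1, …, N(k) + 4k + 1`; row `0` is `(0, …, 0, y_0, …, y_{4k+1})`,
the other rows are those of `(U V)`. -/
def M (k : ℕ) : Matrix (Fin (N k + 4 * k + 1)) (Fin (N k + 4 * k + 1)) ℚ :=
  fun r c =>
    -- the labels of the row and of the column
    let i := (r : ℕ)
    let j := (c : ℕ) + 1
    if i = 0 then
      if j < N k then 0 else y k (j - N k)
    else if j < N k then
      -- the matrix `U`
      if i = j then (j : ℚ) * (-4) ^ k
      else if i = j + 1 then -(4 * (j : ℚ) + 2) * (-4) ^ k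
      else if i = j + 4 * k then (N k : ℚ) - (j : ℚ)
      else if i = j + 4 * k + 1 then -(4 * (N k : ℚ) - 4 * (j : ℚ) - 2)
      else 0
    else
      -- the matrix `V`
      if i = 4 * (j - N k) * k + 1 then ((-4) ^ ((j - N k) * k))⁻¹
      else 0

end PiSeries

namespace PiSeries

/-! ### Determinants triangular up to a permutation -/

section Triangular

open Finset Equiv

/-! Put m = 4k, n = m - 1, c = (-4)^k. Grouped by the position t inside a block instead of by
blocks, M^X is itself block bidiagonal. Since N(k) = m(m+1), each of its nonzero blocks is an (m+1)
× m bidiagonal matrix with entries -αc(i+m+1-ρ) and α(i-ρ) for a single root ρ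
(`blockBidiagonal_eq_monomialMatrix`). Read row i as the polynomial c^i `kernelPoly K m i` and
column i as c^(i+1) `kernelPolyDiff K m i`: by `kernelPoly_pencil` every block becomes
multiplication by α(m+1)(z-ρ), from degree < m to degree ≤ m, and the top row becomes a multiple of
evaluation at m - 1/m.

In the Newton basis whose nodes r_t are the roots of the diagonal blocks, these multiplications are
bidiagonal and the t-th diagonal block has a zero in its t-th diagonal entry. These zeros make the
whole matrix triangular along the matching `matchRow`. The differences between m - 1/m and r_a give
the linear factors; the differences between r_a and the superdiagonal roots s_b give the double
product. The determinants of the two changes of basis do not depend on the nodes, and at the nodes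
m+1, m+2, … they are triangular.

The roots have Y_t in their denominators, so the argument runs over a field with all Y_t nonzero;
passing to the fraction field gives the polynomial identity (`det_MX`). At the specialisation the
linear and resultant factors are odd integers, hence nonzero.

For M, take a vector in its kernel. The rows 4qk+1 express the last 4k+2 coordinates through the
others. Substituted into row 0, they telescope to the top row of the specialised M^X
(`sum_y_mul_uRow`). The bottom rows kill the coordinates strictly between 16k² and N(k), and the
remaining equations say that the first 16k² coordinates form a kernel vector of the specialised M^X,
hence vanish. -/

/-- A square matrix whose off-diagonal nonzero entries all strictly decrease some key is
triangular up to a simultaneous permutation of rows and columns. -/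
theorem det_eq_prod_diag_of_key {ι R : Type*} [Fintype ι] [DecidableEq ι] [CommRing R]
    (A : Matrix ι ι R) (b : ι → ℕ) (h : ∀ i j, i ≠ j → A i j ≠ 0 → b j < b i) :
    A.det = ∏ i, A i i := by
  rw [Matrix.det_apply, Finset.sum_eq_single 1]
  · simp
  · intro σ _ hσ
    obtain ⟨a, ha⟩ : ∃ a, σ a ≠ a := by
      by_contra! hall
      exact hσ (Equiv.ext hall)
    suffices hz : ∃ i, A (σ i) i = 0 by
      obtain ⟨i, hi⟩ := hz
      have h0 : ∏ j, A (σ j) j = 0 := Finset.prod_eq_zero (mem_univ i) hi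
      exact (congrArg (Perm.sign σ • ·) h0).trans (smul_zero _)
    by_contra! hnz
    have hle : ∀ i, b i ≤ b (σ i) := fun i => by
      by_cases hi : σ i = i
      · rw [hi]
      · exact (h _ _ hi (hnz i)).le
    -- A permutation preserves the sum of the keys, so it cannot weakly raise every key and strictly
    -- raise one.
    have hlt : ∑ i, b i < ∑ i, b (σ i) :=
      Finset.sum_lt_sum (fun i _ => hle i) ⟨a, mem_univ a, h _ _ ha (hnz a)⟩
    rw [Equiv.sum_comp σ b] at hlt
    exact lt_irrefl _ hlt
  · simp

end Triangular

/-! ### Newton bases and node-independent determinants -/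

section Newton

open Polynomial Finset

variable {K : Type*} [Field K]

/-- The Newton basis polynomial `∏_{b < j} (X - r b)`. -/
noncomputable def newtonPoly (r : ℕ → K) (j : ℕ) : K[X] := ∏ b ∈ range j, (X - C (r b))

theorem newtonPoly_succ (r : ℕ → K) (j : ℕ) :
    newtonPoly r (j + 1) = newtonPoly r j * (X - C (r j)) := prod_range_succ _ _

theorem newtonPoly_monic (r : ℕ → K) (j : ℕ) : (newtonPoly r j).Monic :=
  monic_prod_of_monic _ _ fun _ _ => monic_X_sub_C _

theorem newtonPoly_degree (r : ℕ → K) (j : ℕ) : (newtonPoly r j).degree = j := by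
  simp [newtonPoly, degree_prod]

/-- The Newton basis polynomials as a sequence of polynomials of degrees `0, 1, 2, …`. -/
noncomputable def newtonSequence (r : ℕ → K) : Polynomial.Sequence K :=
  ⟨newtonPoly r, newtonPoly_degree r⟩

theorem newtonSequence_isUnit (r : ℕ → K) (i : ℕ) :
    IsUnit ((newtonSequence r) i).leadingCoeff := by
  have : (newtonSequence r) i = newtonPoly r i := rfl
  rw [this, (newtonPoly_monic r i).leadingCoeff]
  exact isUnit_one

/-- The coefficients of a polynomial in the Newton basis with nodes `r 0, r 1, …`. -/
noncomputable def newtonCoeff (r : ℕ → K) (l : ℕ) : K[X] →ₗ[K] K :=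
  ((newtonSequence r).basis (newtonSequence_isUnit r)).coord l

theorem newtonCoeff_newtonPoly (r : ℕ → K) (l j : ℕ) :
    newtonCoeff r l (newtonPoly r j) = if j = l then 1 else 0 := by
  have h : newtonPoly r j = (newtonSequence r).basis (newtonSequence_isUnit r) j := by
    rw [Polynomial.Sequence.basis_eq_self]
    rfl
  rw [newtonCoeff, h, Module.Basis.coord_apply, Module.Basis.repr_self, Finsupp.single_apply]

theorem exists_newton_expansion (r : ℕ → K) (n : ℕ) (f : K[X]) (hf : f.degree < n) :
    ∃ a : ℕ → K, f = ∑ l ∈ range n, C (a l) * newtonPoly r l := by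
  induction n generalizing f with
  | zero =>
    refine ⟨0, ?_⟩
    simpa using hf
  | succ n ih =>
    have hd : (f - C (f.coeff n) * newtonPoly r n).degree < n := by
      rw [degree_lt_iff_coeff_zero]
      intro i hi
      have hπ : (newtonPoly r n).natDegree = n :=
        natDegree_eq_of_degree_eq_some (newtonPoly_degree r n)
      rcases hi.eq_or_lt with rfl | hlt
      · have := (newtonPoly_monic r n).coeff_natDegree
        rw [hπ] at this
        simp [this]
      · rw [coeff_sub, coeff_C_mul, coeff_eq_zero_of_natDegree_lt (hπ.trans_lt hlt),
          (degree_lt_iff_coeff_zero f (n + 1)).1 (by exact_mod_cast hf) i hlt]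
        simp
    obtain ⟨a, ha⟩ := ih _ hd
    refine ⟨Function.update a n (f.coeff n), ?_⟩
    rw [sum_range_succ, Function.update_self,
      sum_congr rfl (g := fun l => C (a l) * newtonPoly r l)]
    · rw [← ha]; ring
    · intro l hl
      rw [Function.update_of_ne (mem_range.1 hl).ne]

theorem newtonCoeff_C_mul (r : ℕ → K) (l : ℕ) (a : K) (f : K[X]) :
    newtonCoeff r l (C a * f) = a * newtonCoeff r l f := by
  rw [← smul_eq_C_mul, map_smul, smul_eq_mul]

theorem newtonCoeff_sum (r : ℕ → K) (n l : ℕ) (a : ℕ → K) :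
    newtonCoeff r l (∑ i ∈ range n, C (a i) * newtonPoly r i) = if l < n then a l else 0 := by
  simp [newtonCoeff_C_mul, newtonCoeff_newtonPoly]

theorem newtonCoeff_eq_zero (r : ℕ → K) {n l : ℕ} {f : K[X]} (hf : f.degree < n) (h : n ≤ l) :
    newtonCoeff r l f = 0 := by
  obtain ⟨a, rfl⟩ := exists_newton_expansion r n f hf
  rw [newtonCoeff_sum, if_neg h.not_gt]

theorem newton_expansion (r : ℕ → K) {n : ℕ} {f : K[X]} (hf : f.degree < n) :
    f = ∑ l ∈ range n, C (newtonCoeff r l f) * newtonPoly r l := by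
  obtain ⟨a, ha⟩ := exists_newton_expansion r n f hf
  conv_lhs => rw [ha]
  refine sum_congr rfl fun l hl => ?_
  rw [ha, newtonCoeff_sum, if_pos (mem_range.1 hl)]

theorem exists_degree_lt (f : K[X]) : ∃ n : ℕ, f.degree < n :=
  ⟨f.natDegree + 1, degree_le_natDegree.trans_lt (by exact_mod_cast Nat.lt_succ_self _)⟩

/-- Write X - a as (X - r_i) + (r_i - a) on the i-th basis element. Multiplication by X - a is
therefore bidiagonal, and its diagonal entry vanishes wherever a is the node. -/
theorem newtonCoeff_mul_X_sub_C (r : ℕ → K) (l : ℕ) (a : K) (f : K[X]) :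
    newtonCoeff r l ((X - C a) * f) =
      (if l = 0 then 0 else newtonCoeff r (l - 1) f) + (r l - a) * newtonCoeff r l f := by
  obtain ⟨n, hn⟩ := exists_degree_lt f
  obtain ⟨b, hb⟩ := exists_newton_expansion r n f hn
  have key : ∀ i, newtonCoeff r l ((X - C a) * (C (b i) * newtonPoly r i)) =
      (if l = 0 then 0 else newtonCoeff r (l - 1) (C (b i) * newtonPoly r i))
        + (r l - a) * newtonCoeff r l (C (b i) * newtonPoly r i) := by
    intro i
    have h : (X - C a) * (C (b i) * newtonPoly r i)
        = C (b i) * newtonPoly r (i + 1) + C ((r i - a) * b i) * newtonPoly r i := by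
      rw [newtonPoly_succ, C_mul, C_sub]; ring
    simp only [h, map_add, newtonCoeff_C_mul, newtonCoeff_newtonPoly]
    rcases l with _ | l
    · by_cases h0 : i = 0 <;> simp [h0]
    · by_cases h1 : i = l
      · subst h1; simp
      · by_cases h2 : i = l + 1
        · subst h2; simp
        · simp [h1, h2]
  conv_lhs => rw [hb, mul_sum, map_sum, sum_congr rfl fun i _ => key i, sum_add_distrib,
    ← mul_sum, ← map_sum, ← hb]
  congr 1
  split_ifs
  · simp
  · rw [← map_sum, ← hb]

theorem newtonCoeff_newtonPoly_mul_of_lt (r : ℕ → K) (i l : ℕ) (hl : l < i) (g : K[X]) :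
    newtonCoeff r l (newtonPoly r i * g) = 0 := by
  induction i generalizing l with
  | zero => omega
  | succ i ih =>
    have h : newtonPoly r (i + 1) * g = (X - C (r i)) * (newtonPoly r i * g) := by
      rw [newtonPoly_succ]; ring
    rw [h, newtonCoeff_mul_X_sub_C]
    have h1 : (if l = 0 then 0 else newtonCoeff r (l - 1) (newtonPoly r i * g)) = 0 := by
      split_ifs
      · rfl
      · exact ih _ (by omega)
    rw [h1, zero_add]
    -- At l = i the factor r_i - r_i vanishes; below that the induction hypothesis applies. Repeated
    -- nodes cause no trouble.
    rcases (Nat.lt_succ_iff.1 hl).eq_or_lt with rfl | hlt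
    · rw [sub_self, zero_mul]
    · rw [ih _ hlt, mul_zero]

theorem newtonCoeff_newtonPoly_mul_self (r : ℕ → K) (i : ℕ) (g : K[X]) :
    newtonCoeff r i (newtonPoly r i * g) = g.eval (r i) := by
  obtain ⟨q, hq⟩ := X_sub_C_dvd_sub_C_eval (a := r i) (p := g)
  have hg : newtonPoly r i * g
      = C (g.eval (r i)) * newtonPoly r i + newtonPoly r (i + 1) * q := by
    rw [newtonPoly_succ, mul_assoc, ← hq]; ring
  rw [hg, map_add, newtonCoeff_newtonPoly_mul_of_lt r _ _ (Nat.lt_succ_self i),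
    newtonCoeff_C_mul, newtonCoeff_newtonPoly, if_pos rfl, mul_one, add_zero]

/-- The matrix of Newton coefficients of `f 0, …, f (n-1)`, one polynomial per column. -/
noncomputable def newtonMatrix (r : ℕ → K) (n : ℕ) (f : ℕ → K[X]) : Matrix (Fin n) (Fin n) K :=
  Matrix.of fun j i => newtonCoeff r j (f i)

theorem det_newtonMatrix_newtonPoly (r r' : ℕ → K) (n : ℕ) :
    (newtonMatrix r n (newtonPoly r')).det = 1 := by
  rw [Matrix.det_of_isUpperTriangular]
  · refine prod_eq_one fun i _ => ?_
    have hd : (newtonPoly r' i - newtonPoly r i).degree < (i : ℕ) := by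
      rw [← newtonPoly_degree r' i]
      refine degree_sub_lt_left (by rw [newtonPoly_degree, newtonPoly_degree])
        (newtonPoly_monic r' i).ne_zero ?_
      rw [(newtonPoly_monic r' i).leadingCoeff, (newtonPoly_monic r i).leadingCoeff]
    have h := newtonCoeff_eq_zero r hd le_rfl
    rw [map_sub, newtonCoeff_newtonPoly, if_pos rfl, sub_eq_zero] at h
    exact h
  · intro j i hij
    exact newtonCoeff_eq_zero r (n := i + 1)
      (by rw [newtonPoly_degree]; exact_mod_cast Nat.lt_succ_self _) hij

/-- Two Newton bases differ by a unitriangular matrix, both being monic of the same degrees. Hence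
the changes of basis can be evaluated at convenient nodes, unrelated to those that triangularise the
main matrix. -/
theorem det_newtonMatrix_eq (r r' : ℕ → K) (n : ℕ) (f : ℕ → K[X])
    (hf : ∀ i < n, (f i).degree < n) :
    (newtonMatrix r n f).det = (newtonMatrix r' n f).det := by
  have h : newtonMatrix r n f = newtonMatrix r n (newtonPoly r') * newtonMatrix r' n f := by
    ext j i
    rw [Matrix.mul_apply]
    simp only [newtonMatrix, Matrix.of_apply]
    conv_lhs => rw [newton_expansion r' (hf i i.2), map_sum]
    rw [← Fin.sum_univ_eq_sum_range
      (fun l => newtonCoeff r j (C (newtonCoeff r' l (f i)) * newtonPoly r' l))]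
    refine sum_congr rfl fun l _ => ?_
    rw [newtonCoeff_C_mul, mul_comm]
  rw [h, Matrix.det_mul, det_newtonMatrix_newtonPoly, one_mul]

theorem det_newtonMatrix_of_eq_mul (r r' : ℕ → K) (n : ℕ) (f g : ℕ → K[X])
    (hf : ∀ i < n, (f i).degree < n) (hfg : ∀ i < n, f i = newtonPoly r' i * g i) :
    (newtonMatrix r n f).det = ∏ i ∈ range n, (g i).eval (r' i) := by
  rw [det_newtonMatrix_eq r r' n f hf, Matrix.det_of_isLowerTriangular,
    ← Fin.prod_univ_eq_prod_range (fun i => (g i).eval (r' i))]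
  · refine prod_congr rfl fun i _ => ?_
    rw [newtonMatrix, Matrix.of_apply, hfg i i.2, newtonCoeff_newtonPoly_mul_self]
  · intro j i hij
    rw [newtonMatrix, Matrix.of_apply, hfg i i.2]
    exact newtonCoeff_newtonPoly_mul_of_lt r' _ _ hij _

end Newton

/-! ### The polynomials that turn a pencil into a multiplication -/

section KernelPolynomials

open Polynomial Finset

variable {K : Type*} [Field K]

/-- `∏_{j<i} (j+m+1-z) ∏_{i≤j<m} (j-z)`: as `i` varies, the left kernel of the
`(m+1) × m` pencil with entries `-(i+m+1-z)` and `i-z` on the two diagonals. -/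
noncomputable def kernelPoly (K : Type*) [Field K] (m i : ℕ) : K[X] :=
  (∏ j ∈ range i, (C ((j : K) + m + 1) - X)) * ∏ j ∈ Ico i m, (C (j : K) - X)

/-- `∏_{j<i} (j+m+1-z) ∏_{i<j<m} (j-z)`. -/
noncomputable def kernelPolyDiff (K : Type*) [Field K] (m i : ℕ) : K[X] :=
  (∏ j ∈ range i, (C ((j : K) + m + 1) - X)) * ∏ j ∈ Ico (i + 1) m, (C (j : K) - X)

/-- After the common factors are removed, what remains is -(i+m+1-r)(i-z) + (i-r)(i+m+1-z) =
(m+1)(z-r). At z = r it vanishes, which is the kernel property. -/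
theorem kernelPoly_pencil (m i : ℕ) (hi : i < m) (r : K) :
    C (-((i : K) + m + 1 - r)) * kernelPoly K m i + C ((i : K) - r) * kernelPoly K m (i + 1)
      = C ((m : K) + 1) * ((X - C r) * kernelPolyDiff K m i) := by
  rw [kernelPoly, kernelPoly, kernelPolyDiff, prod_range_succ, prod_eq_prod_Ico_succ_bot hi]
  simp only [C_neg, C_sub, C_add, C_1]
  ring

theorem prod_C_sub_X (s : Finset ℕ) (a : ℕ → K) :
    ∏ j ∈ s, (C (a j) - X) = C ((-1) ^ #s) * ∏ j ∈ s, (X - C (a j)) := by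
  rw [C_pow, C_neg, C_1, ← prod_const, ← prod_mul_distrib]
  exact prod_congr rfl fun _ _ => by ring

theorem degree_prod_C_sub_X (s : Finset ℕ) (a : ℕ → K) :
    (∏ j ∈ s, (C (a j) - X)).degree = ((#s : ℕ) : WithBot ℕ) := by
  rw [prod_C_sub_X, degree_C_mul (by simp), degree_prod]
  simp

theorem kernelPoly_degree (m i : ℕ) (hi : i ≤ m) : (kernelPoly K m i).degree = m := by
  rw [kernelPoly, degree_mul, degree_prod_C_sub_X, degree_prod_C_sub_X, card_range,
    Nat.card_Ico]
  exact_mod_cast Nat.add_sub_of_le hi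

theorem kernelPolyDiff_degree (m i : ℕ) (hi : i < m) :
    (kernelPolyDiff K m i).degree = (m - 1 : ℕ) := by
  rw [kernelPolyDiff, degree_mul, degree_prod_C_sub_X, degree_prod_C_sub_X, card_range,
    Nat.card_Ico, ← Nat.cast_add]
  congr 1
  omega

/-- The nodes `m+1, m+2, …` which make the Newton matrices of the kernel polynomials
triangular. -/
def shiftedNode (K : Type*) [Field K] (m j : ℕ) : K := (j : K) + m + 1

theorem eval_prod_C_sub_X (m i a : ℕ) :
    (C ((-1) ^ i) * ∏ j ∈ Ico a m, (C (j : K) - X)).eval (shiftedNode K m i)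
      = (-1) ^ (i + (m - a)) * ∏ j ∈ Ico a m, ((i : K) + m + 1 - j) := by
  rw [eval_mul, eval_C, eval_prod, pow_add, mul_assoc]
  congr 1
  rw [← Nat.card_Ico, ← prod_const, ← prod_mul_distrib]
  refine prod_congr rfl fun j _ => ?_
  simp [shiftedNode]

theorem prod_factorial_quotient (m i a : ℕ) (ha : a ≤ m) :
    (∏ j ∈ Ico a m, ((i : K) + m + 1 - j)) * ((i + 1).factorial : K)
      = ((i + 1 + (m - a)).factorial : K) := by
  obtain ⟨d, rfl⟩ := Nat.exists_eq_add_of_le ha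
  rw [Nat.add_sub_cancel_left, prod_Ico_eq_prod_range, Nat.add_sub_cancel_left]
  induction d with
  | zero => simp
  | succ d ih =>
    have ih' := ih (Nat.le_add_right a d)
    rw [show i + 1 + (d + 1) = (i + 1 + d) + 1 by ring, Nat.factorial_succ (i + 1 + d),
      Nat.cast_mul, ← ih', prod_range_succ',
      prod_congr rfl (g := fun j : ℕ => (i : K) + ((a + d : ℕ) : K) + 1 - ((a + j : ℕ) : K))
        fun j _ => by push_cast; ring]
    push_cast
    ring

/-- At the nodes m+1, m+2, … the first product in `kernelPoly` is, up to sign, the i-th Newton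
polynomial. The matrix is then lower triangular, and its diagonal consists of the second product
evaluated at the i-th node. -/
theorem det_newtonMatrix_kernelPoly (r : ℕ → K) (m : ℕ) (c : K) :
    (newtonMatrix r (m + 1) fun i => C (c ^ i) * kernelPoly K m i).det
      = ∏ i ∈ range (m + 1), (c ^ i * (-1) ^ m * ∏ j ∈ Ico i m, ((i : K) + m + 1 - j)) := by
  rw [det_newtonMatrix_of_eq_mul r (shiftedNode K m) (m + 1) _
    (fun i => C (c ^ i) * (C ((-1) ^ i) * ∏ j ∈ Ico i m, (C (j : K) - X)))]
  · refine prod_congr rfl fun i hi => ?_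
    have him : i ≤ m := Nat.lt_succ_iff.1 (mem_range.1 hi)
    rw [eval_mul, eval_prod_C_sub_X, eval_C, Nat.add_sub_of_le him, mul_assoc]
  · intro i hi
    refine (degree_mul_le _ _).trans_lt ?_
    rw [kernelPoly_degree _ _ (Nat.lt_succ_iff.1 hi)]
    refine (add_le_add_left degree_C_le _).trans_lt ?_
    rw [zero_add]
    exact_mod_cast Nat.lt_succ_self m
  · intro i _
    rw [kernelPoly, prod_C_sub_X, card_range, newtonPoly]
    simp only [shiftedNode]
    ring

theorem det_newtonMatrix_kernelPolyDiff (r : ℕ → K) (m : ℕ) (c : K) :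
    (newtonMatrix r m fun i => C (c ^ (i + 1)) * kernelPolyDiff K m i).det
      = ∏ i ∈ range m,
          (c ^ (i + 1) * (-1) ^ (m - 1) * ∏ j ∈ Ico (i + 1) m, ((i : K) + m + 1 - j)) := by
  rw [det_newtonMatrix_of_eq_mul r (shiftedNode K m) m _
    (fun i => C (c ^ (i + 1)) * (C ((-1) ^ i) * ∏ j ∈ Ico (i + 1) m, (C (j : K) - X)))]
  · refine prod_congr rfl fun i hi => ?_
    have him : i < m := mem_range.1 hi
    rw [eval_mul, eval_prod_C_sub_X, eval_C, mul_assoc,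
      show i + (m - (i + 1)) = m - 1 by omega]
  · intro i hi
    refine (degree_mul_le _ _).trans_lt ?_
    rw [kernelPolyDiff_degree _ _ hi]
    refine (add_le_add_left degree_C_le _).trans_lt ?_
    rw [zero_add]
    exact_mod_cast (by omega : m - 1 < m)
  · intro i _
    rw [kernelPolyDiff, prod_C_sub_X, card_range, newtonPoly]
    simp only [shiftedNode]
    ring

end KernelPolynomials

/-! ### Block bidiagonal matrices and the matching -/

section BlockBidiagonal

open Finset

/-- Row indices: a top row, and rows `(t, p)` with `t` the position inside a block row `p`. -/
abbrev BlockRow (n : ℕ) : Type := Unit ⊕ Fin n × Fin (n + 2)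

/-- Column indices `(s, i)`, with `s` the position inside a block column `i`. -/
abbrev BlockCol (n : ℕ) : Type := Fin (n + 1) × Fin (n + 1)

/-- The matrix with blocks `(t, t)` and `(t, t+1)` which are `(n+2) × (n+1)` and bidiagonal, and
with a top row supported on the last column block. -/
def blockBidiagonal {R : Type*} [CommRing R] (n : ℕ) (top : ℕ → R) (a₀ a₁ b₀ b₁ : ℕ → ℕ → R) :
    Matrix (BlockRow n) (BlockCol n) R
  | Sum.inl _, (s, i) => if (s : ℕ) = n then top i else 0
  | Sum.inr (t, p), (s, i) =>
    if (s : ℕ) = t then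
      if (p : ℕ) = i then a₀ t i else if (p : ℕ) = i + 1 then a₁ t i else 0
    else if (s : ℕ) = t + 1 then
      if (p : ℕ) = i then b₀ t i else if (p : ℕ) = i + 1 then b₁ t i else 0
    else 0

/-- The matching of columns and rows along which the matrix in the Newton basis is triangular. -/
def matchRow (n : ℕ) : BlockCol n ≃ BlockRow n where
  toFun x :=
    if h : (x.2 : ℕ) < x.1 then Sum.inr (⟨x.1 - 1, by omega⟩, ⟨x.2, by omega⟩)
    else if h' : (x.1 : ℕ) = n then Sum.inl ()
    else Sum.inr (⟨x.1, by omega⟩, ⟨x.2 + 1, by omega⟩)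
  invFun y := match y with
    | Sum.inl _ => (⟨n, by omega⟩, ⟨n, by omega⟩)
    | Sum.inr (t, p) =>
      if h : (p : ℕ) ≤ t then (⟨t + 1, by omega⟩, ⟨p, by omega⟩)
      else (⟨t, by omega⟩, ⟨p - 1, by omega⟩)
  left_inv x := by
    obtain ⟨⟨s, hs⟩, ⟨j, hj⟩⟩ := x
    by_cases h : j < s
    · have h2 : j ≤ s - 1 := by omega
      have h3 : s - 1 + 1 = s := by omega
      simp [h, h2, h3]
    · by_cases h' : s = n
      · have : j = n := by omega
        subst h'
        simp [this]
      · have h2 : ¬ (j + 1 ≤ s) := by omega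
        simp [h, h', h2]
  right_inv y := by
    rcases y with u | ⟨⟨t, ht⟩, ⟨p, hp⟩⟩
    · simp
    · by_cases h : p ≤ t
      · have h2 : p < t + 1 := by omega
        simp [h, h2]
      · have h2 : ¬ (p - 1 < t) := by omega
        have h3 : t ≠ n := by omega
        have h4 : p - 1 + 1 = p := by omega
        simp [h, h2, h3, h4]

variable {R : Type*} [CommRing R]

/-- The key along which the matched matrix is triangular. -/
def matchKey (n : ℕ) (x : BlockCol n) : ℕ :=
  if (x.2 : ℕ) < x.1 then x.1 + x.2 else 10 * (n + 1) - (x.1 + x.2)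

theorem matchRow_of_lt (n : ℕ) (s j : Fin (n + 1)) (h : (j : ℕ) < s) :
    matchRow n (s, j) = Sum.inr (⟨s - 1, by omega⟩, ⟨j, by omega⟩) :=
  dif_pos h

theorem matchRow_last (n : ℕ) (s j : Fin (n + 1)) (h : ¬ (j : ℕ) < s) (h' : (s : ℕ) = n) :
    matchRow n (s, j) = Sum.inl () :=
  (dif_neg h).trans (dif_pos h')

theorem matchRow_of_ge (n : ℕ) (s j : Fin (n + 1)) (h : ¬ (j : ℕ) < s) (h' : (s : ℕ) ≠ n) :
    matchRow n (s, j) = Sum.inr (⟨s, by omega⟩, ⟨j + 1, by omega⟩) :=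
  (dif_neg h).trans (dif_neg h')

/-- Column (s, j) is matched with an entry `b₀` of the superdiagonal block if j < s, and otherwise
with an entry `a₁` of the diagonal block or, at (n, n), with the top row. The low keys s + j
increase and the high keys 10(n+1) - (s + j) decrease along the block; the constant only has to
separate the two ranges. -/
theorem det_matched_blockBidiagonal (n : ℕ) (top : ℕ → R) (a₀ a₁ b₀ b₁ : ℕ → ℕ → R)
    (ha : ∀ t < n, a₀ t t = 0) :
    ((blockBidiagonal n top a₀ a₁ b₀ b₁).submatrix (matchRow n) id).det
      = top n * ∏ t ∈ range n, ((∏ j ∈ Ico t (n + 1), a₁ t j) * ∏ j ∈ range (t + 1), b₀ t j) := by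
  rw [det_eq_prod_diag_of_key _ (matchKey n)]
  · rw [Fintype.prod_prod_type]
    have hrow : ∀ s : Fin (n + 1), ∏ j : Fin (n + 1),
        (blockBidiagonal n top a₀ a₁ b₀ b₁).submatrix (matchRow n) id (s, j) (s, j)
        = (∏ j ∈ range s, b₀ (s - 1) j)
          * (if (s : ℕ) = n then top n else ∏ j ∈ Ico (s : ℕ) (n + 1), a₁ s j) := by
      intro s
      have hfun : ∀ j : Fin (n + 1),
          (blockBidiagonal n top a₀ a₁ b₀ b₁).submatrix (matchRow n) id (s, j) (s, j)
          = (fun j : ℕ => if j < s then b₀ (s - 1) j else if (s : ℕ) = n then top j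
              else a₁ s j) j := by
        intro j
        rw [Matrix.submatrix_apply, id]
        by_cases h : (j : ℕ) < s
        · have h1 : (s : ℕ) ≠ s - 1 := by omega
          have h2 : (s : ℕ) = s - 1 + 1 := by omega
          rw [matchRow_of_lt n s j h]
          simp only [blockBidiagonal, if_neg h1, if_pos h2, if_true, if_pos h]
        · by_cases h' : (s : ℕ) = n
          · rw [matchRow_last n s j h h']
            simp only [blockBidiagonal, if_pos h', if_neg h]
          · rw [matchRow_of_ge n s j h h']
            simp [blockBidiagonal, h', h]
      rw [prod_congr rfl fun j _ => hfun j,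
        Fin.prod_univ_eq_prod_range (fun j : ℕ => if j < s then b₀ (s - 1) j
          else if (s : ℕ) = n then top j else a₁ s j),
        ← prod_range_mul_prod_Ico _ s.2.le]
      congr 1
      · exact prod_congr rfl fun j hj => by rw [if_pos (mem_range.1 hj)]
      · rw [prod_congr rfl (g := fun j => if (s : ℕ) = n then top j else a₁ s j)
          fun j hj => by rw [if_neg (mem_Ico.1 hj).1.not_gt]]
        split_ifs with hs
        · rw [hs]; simp
        · rfl
    rw [prod_congr rfl fun s _ => hrow s,
      Fin.prod_univ_eq_prod_range (fun s => (∏ j ∈ range s, b₀ (s - 1) j)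
          * (if s = n then top n else ∏ j ∈ Ico s (n + 1), a₁ s j)), prod_mul_distrib,
      prod_range_succ', prod_range_succ (fun s => if s = n then top n else _),
      prod_mul_distrib]
    simp only [Nat.add_sub_cancel, range_zero, prod_empty, mul_one, if_true]
    have hif : ∏ s ∈ range n, (if s = n then top n else ∏ j ∈ Ico s (n + 1), a₁ s j)
        = ∏ s ∈ range n, ∏ j ∈ Ico s (n + 1), a₁ s j :=
      prod_congr rfl fun s hs => by rw [if_neg (mem_range.1 hs).ne]
    rw [hif]
    ring
  · rintro ⟨⟨s, hs⟩, ⟨j, hj⟩⟩ ⟨⟨s', hs'⟩, ⟨j', hj'⟩⟩ hne hA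
    have hne' : ¬ (s = s' ∧ j = j') := by
      rintro ⟨rfl, rfl⟩; exact hne rfl
    rw [Matrix.submatrix_apply, id] at hA
    simp only [matchKey]
    by_cases h : j < s
    · rw [matchRow_of_lt n ⟨s, hs⟩ ⟨j, hj⟩ h] at hA
      simp only [blockBidiagonal] at hA
      -- The entry `a₀` in position (s-1, s-1) is the only one leading from a low key to a high key;
      -- `ha` removes it.
      have h0 : ¬ (s' = s - 1 ∧ j = j' ∧ j' = s - 1) := by
        rintro ⟨h1, h2, h3⟩
        rw [if_pos h1, if_pos h2, h3] at hA
        exact hA (ha _ (by omega))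
      grind
    · by_cases h' : s = n
      · rw [matchRow_last n ⟨s, hs⟩ ⟨j, hj⟩ h h'] at hA
        simp only [blockBidiagonal] at hA
        grind
      · rw [matchRow_of_ge n ⟨s, hs⟩ ⟨j, hj⟩ h h'] at hA
        simp only [blockBidiagonal] at hA
        grind

end BlockBidiagonal

/-! ### Passing from the monomial pencil to the Newton basis -/

section ChangeOfBasis

open Polynomial Finset Matrix
open scoped Kronecker

theorem sum_mul_bidiagonal {R : Type*} [CommRing R] (n i : ℕ) (hi : i < n + 1) (g : ℕ → R)
    (a b : R) :
    ∑ p : Fin (n + 2), g p * (if (p : ℕ) = i then a else if (p : ℕ) = i + 1 then b else 0)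
      = g i * a + g (i + 1) * b := by
  rw [Fin.sum_univ_eq_sum_range
    (fun p => g p * (if p = i then a else if p = i + 1 then b else 0)) (n + 2)]
  have h : ∀ p, g p * (if p = i then a else if p = i + 1 then b else 0)
      = (if p = i then g p * a else 0) + (if p = i + 1 then g p * b else 0) := by
    intro p
    by_cases h1 : p = i
    · simp [h1]
    · by_cases h2 : p = i + 1 <;> simp [h1, h2]
  rw [sum_congr rfl fun p _ => h p, sum_add_distrib, sum_ite_eq', sum_ite_eq',
    if_pos (mem_range.2 (by omega)), if_pos (mem_range.2 (by omega))]

theorem sum_bidiagonal_mul {R : Type*} [CommRing R] (n l : ℕ) (hl : l < n + 2) (g : ℕ → R)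
    (hg : g (n + 1) = 0) (a b : ℕ → R) :
    ∑ j : Fin (n + 1), (if l = (j : ℕ) then a j else if l = j + 1 then b j else 0) * g j
      = a l * g l + (if l = 0 then 0 else b (l - 1) * g (l - 1)) := by
  rw [Fin.sum_univ_eq_sum_range
    (fun j => (if l = j then a j else if l = j + 1 then b j else 0) * g j) (n + 1)]
  have h : ∀ j, (if l = j then a j else if l = j + 1 then b j else 0) * g j
      = (if l = j then a j * g j else 0) + (if l = j + 1 then b j * g j else 0) := by
    intro p
    by_cases h1 : l = p
    · simp [h1]
    · by_cases h2 : l = p + 1 <;> simp [h1, h2]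
  rw [sum_congr rfl fun p _ => h p, sum_add_distrib, sum_ite_eq]
  congr 1
  · split_ifs with h1
    · rfl
    · rw [show l = n + 1 by simp at h1; omega, hg, mul_zero]
  · rcases l with _ | l
    · simp
    · simp only [Nat.add_right_cancel_iff, sum_ite_eq, Nat.add_sub_cancel]
      rw [if_pos (mem_range.2 (by omega)), if_neg (Nat.succ_ne_zero l)]

variable {K : Type*} [Field K]

/-- Applies the same change of basis to every row block, and fixes the top row. -/
def rowChange (n : ℕ) (P : Matrix (Fin (n + 2)) (Fin (n + 2)) K) :
    Matrix (BlockRow n) (BlockRow n) K :=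
  fromBlocks (1 : Matrix Unit Unit K) 0 0 ((1 : Matrix (Fin n) (Fin n) K) ⊗ₖ P)

/-- Applies the same change of basis to every column block. -/
def colChange (n : ℕ) (Q : Matrix (Fin (n + 1)) (Fin (n + 1)) K) :
    Matrix (BlockCol n) (BlockCol n) K :=
  (1 : Matrix (Fin (n + 1)) (Fin (n + 1)) K) ⊗ₖ Q

theorem det_rowChange (n : ℕ) (P : Matrix (Fin (n + 2)) (Fin (n + 2)) K) :
    (rowChange n P).det = P.det ^ n := by
  rw [rowChange, det_fromBlocks_zero₂₁, det_kronecker]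
  simp

theorem det_colChange (n : ℕ) (Q : Matrix (Fin (n + 1)) (Fin (n + 1)) K) :
    (colChange n Q).det = Q.det ^ (n + 1) := by
  rw [colChange, det_kronecker]
  simp

theorem rowChange_mul_top (n : ℕ) (P : Matrix (Fin (n + 2)) (Fin (n + 2)) K)
    (A : Matrix (BlockRow n) (BlockCol n) K) (u : Unit) (x : BlockCol n) :
    (rowChange n P * A) (Sum.inl u) x = A (Sum.inl u) x := by
  simp [Matrix.mul_apply, rowChange]

theorem rowChange_mul_block (n : ℕ) (P : Matrix (Fin (n + 2)) (Fin (n + 2)) K)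
    (A : Matrix (BlockRow n) (BlockCol n) K) (t : Fin n) (l : Fin (n + 2)) (x : BlockCol n) :
    (rowChange n P * A) (Sum.inr (t, l)) x = ∑ p, P l p * A (Sum.inr (t, p)) x := by
  simp [Matrix.mul_apply, rowChange, Fintype.sum_prod_type, Matrix.one_apply, ite_mul]

theorem mul_colChange (n : ℕ) (Q : Matrix (Fin (n + 1)) (Fin (n + 1)) K)
    (A : Matrix (BlockRow n) (BlockCol n) K) (y : BlockRow n) (s i : Fin (n + 1)) :
    (A * colChange n Q) y (s, i) = ∑ j, A y (s, j) * Q j i := by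
  simp [Matrix.mul_apply, colChange, Fintype.sum_prod_type, Matrix.one_apply, ite_mul]

/-- The pencil matrix in the monomial basis. -/
noncomputable def monomialMatrix (n : ℕ) (κ c : K) (r s α β : ℕ → K) :
    Matrix (BlockRow n) (BlockCol n) K :=
  blockBidiagonal n (fun i => κ * (C (c ^ (i + 1)) * kernelPolyDiff K (n + 1) i).eval (r n))
    (fun t i => -(α t * c * ((i : K) + (n + 1 : ℕ) + 1 - r t)))
    (fun t i => α t * ((i : K) - r t))
    (fun t i => -(β t * c * ((i : K) + (n + 1 : ℕ) + 1 - s t)))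
    (fun t i => β t * ((i : K) - s t))

/-- The pencil matrix in the Newton basis. -/
def newtonBasisMatrix (n : ℕ) (κ : K) (r s α β : ℕ → K) :
    Matrix (BlockRow n) (BlockCol n) K :=
  blockBidiagonal n (fun j => κ * ∏ b ∈ range j, (r n - r b))
    (fun t j => α t * ((n + 1 : ℕ) + 1) * (r j - r t))
    (fun t _ => α t * ((n + 1 : ℕ) + 1))
    (fun t j => β t * ((n + 1 : ℕ) + 1) * (r j - s t))
    (fun t _ => β t * ((n + 1 : ℕ) + 1))

theorem degree_C_mul_kernelPolyDiff_lt (n i : ℕ) (hi : i < n + 1) (a : K) :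
    (C a * kernelPolyDiff K (n + 1) i).degree < (n + 1 : ℕ) := by
  refine (degree_mul_le _ _).trans_lt ?_
  rw [kernelPolyDiff_degree _ _ hi]
  refine (add_le_add_left degree_C_le _).trans_lt ?_
  rw [zero_add]
  exact_mod_cast (by omega : n + 1 - 1 < n + 1)

/-- This is `kernelPoly_pencil`, scaled by αc^(i+1), read off in its l-th Newton coefficient. In the
last row l = n+1 the diagonal term is absent, which agrees with the degree bound on
`kernelPolyDiff`. -/
theorem newton_pencil_entry (n : ℕ) (c α ρ : K) (r : ℕ → K) (l i : ℕ) (hl : l < n + 2)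
    (hi : i < n + 1) :
    ∑ p : Fin (n + 2), newtonCoeff r l (C (c ^ (p : ℕ)) * kernelPoly K (n + 1) p)
        * (if (p : ℕ) = i then -(α * c * ((i : K) + (n + 1 : ℕ) + 1 - ρ))
            else if (p : ℕ) = i + 1 then α * ((i : K) - ρ) else 0)
      = ∑ j : Fin (n + 1), (if l = (j : ℕ) then α * ((n + 1 : ℕ) + 1) * (r j - ρ)
            else if l = j + 1 then α * ((n + 1 : ℕ) + 1) else 0)
          * newtonCoeff r j (C (c ^ (i + 1)) * kernelPolyDiff K (n + 1) i) := by
  rw [sum_mul_bidiagonal n i hi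
      (fun p => newtonCoeff r l (C (c ^ p) * kernelPoly K (n + 1) p)),
    sum_bidiagonal_mul n l hl
      (fun j => newtonCoeff r j (C (c ^ (i + 1)) * kernelPolyDiff K (n + 1) i))
      (newtonCoeff_eq_zero r (degree_C_mul_kernelPolyDiff_lt n i hi _) le_rfl)
      (fun j => α * ((n + 1 : ℕ) + 1) * (r j - ρ)) (fun _ => α * ((n + 1 : ℕ) + 1))]
  have h := congrArg (fun f => newtonCoeff r l (C (α * c ^ (i + 1)) * f))
    (kernelPoly_pencil (n + 1) i hi ρ)
  have hr : C (α * c ^ (i + 1)) * (C (((n + 1 : ℕ) : K) + 1)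
        * ((X - C ρ) * kernelPolyDiff K (n + 1) i))
      = C (α * (((n + 1 : ℕ) : K) + 1))
        * ((X - C ρ) * (C (c ^ (i + 1)) * kernelPolyDiff K (n + 1) i)) := by
    simp only [C_mul]; ring
  rw [hr, newtonCoeff_C_mul, newtonCoeff_C_mul, newtonCoeff_mul_X_sub_C, map_add] at h
  simp only [newtonCoeff_C_mul] at h ⊢
  rw [pow_succ] at h ⊢
  split_ifs at h ⊢ <;> linear_combination h

/-- Stated as an intertwining relation, so that neither change of basis has to be inverted. One pair
of changes serves all blocks because the polynomials do not involve the roots. -/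
theorem rowChange_mul_monomialMatrix (n : ℕ) (κ c : K) (r s α β : ℕ → K) :
    rowChange n (newtonMatrix r (n + 2) fun i => C (c ^ i) * kernelPoly K (n + 1) i)
        * monomialMatrix n κ c r s α β
      = newtonBasisMatrix n κ r s α β
        * colChange n (newtonMatrix r (n + 1)
            fun i => C (c ^ (i + 1)) * kernelPolyDiff K (n + 1) i) := by
  ext y ⟨σ, i⟩
  rw [mul_colChange]
  rcases y with u | ⟨t, l⟩
  · rw [rowChange_mul_top]
    simp only [monomialMatrix, newtonBasisMatrix, blockBidiagonal, newtonMatrix, of_apply]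
    split_ifs
    -- Top row: evaluation at `r n` applied to the Newton expansion, each basis element contributing
    -- the product of the differences `r n - r b`.
    · conv_lhs => rw [newton_expansion r (degree_C_mul_kernelPolyDiff_lt n i i.2 _),
        eval_finsetSum, mul_sum]
      rw [← Fin.sum_univ_eq_sum_range (fun l => κ * eval (r n) (C (newtonCoeff r l
        (C (c ^ ((i : ℕ) + 1)) * kernelPolyDiff K (n + 1) i)) * newtonPoly r l))]
      refine sum_congr rfl fun j _ => ?_
      rw [eval_mul, eval_C, newtonPoly, eval_prod]
      simp only [eval_sub, eval_X, eval_C]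
      ring
    · simp
  · rw [rowChange_mul_block]
    simp only [monomialMatrix, newtonBasisMatrix, blockBidiagonal, newtonMatrix, of_apply]
    split_ifs
    · exact newton_pencil_entry n c (α t) (r t) r l i l.2 i.2
    · exact newton_pencil_entry n c (β t) (s t) r l i l.2 i.2
    · simp

theorem det_monomialMatrix_mul (n : ℕ) (κ c : K) (r s α β : ℕ → K) :
    (newtonMatrix r (n + 2) fun i => C (c ^ i) * kernelPoly K (n + 1) i).det ^ n
        * ((monomialMatrix n κ c r s α β).submatrix (matchRow n) id).det
      = (κ * ∏ b ∈ range n, (r n - r b))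
        * (∏ t ∈ range n, ((α t * ((n + 1 : ℕ) + 1)) ^ (n + 1 - t)
            * ∏ a ∈ range (t + 1), (β t * ((n + 1 : ℕ) + 1) * (r a - s t))))
        * (newtonMatrix r (n + 1)
            fun i => C (c ^ (i + 1)) * kernelPolyDiff K (n + 1) i).det ^ (n + 1) := by
  have h := congrArg (fun A => (A.submatrix (matchRow n) id).det)
    (rowChange_mul_monomialMatrix n κ c r s α β)
  rw [← submatrix_mul_equiv _ _ (matchRow n) (matchRow n) id, det_mul,
    det_submatrix_equiv_self, det_rowChange,
    ← submatrix_mul_equiv _ _ (matchRow n) (Equiv.refl _) id, det_mul] at h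
  simp only [Equiv.coe_refl] at h
  rw [submatrix_id_id, det_colChange, newtonBasisMatrix, det_matched_blockBidiagonal] at h
  · rw [h]
    simp
  · intro t _
    rw [sub_self, mul_zero]

end ChangeOfBasis

/-! ### From positions to structured indices, and the sign -/

section Reindexing

open Finset Equiv

variable {R : Type*} [CommRing R]

/-- The position of a column `(s, i)` of the block matrix. -/
def colIndex (n : ℕ) : BlockCol n ≃ Fin ((n + 1) * (n + 1)) :=
  (Equiv.prodComm _ _).trans finProdFinEquiv

theorem colIndex_val (n : ℕ) (x : BlockCol n) :
    (colIndex n x : ℕ) = x.1 + (n + 1) * x.2 := rfl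

theorem rowIndex_lt {n t p : ℕ} (ht : t < n) (hp : p < n + 2) :
    1 + (t + n * p) < (n + 1) * (n + 1) := by
  have : n * p ≤ n * (n + 1) := Nat.mul_le_mul_left n (Nat.lt_succ_iff.1 hp)
  nlinarith

/-- The position of a row of the block matrix. -/
def rowIndex (n : ℕ) : BlockRow n → Fin ((n + 1) * (n + 1))
  | Sum.inl _ => ⟨0, by positivity⟩
  | Sum.inr (t, p) => ⟨1 + (t + n * p), rowIndex_lt t.2 p.2⟩

theorem finRotate_pow_val (n a : ℕ) (i : Fin (n + 1)) :
    (((finRotate (n + 1)) ^ a) i : ℕ) = (i + a) % (n + 1) := by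
  induction a with
  | zero => simp [Nat.mod_eq_of_lt i.2]
  | succ a ih =>
    rw [pow_succ', Perm.mul_apply, finRotate_apply, Fin.val_add, ih, ← add_assoc]
    simp [Nat.add_mod]

/-- Inside the block column `j`, rotate by `j + 1` steps backwards. -/
def blockRotation (n : ℕ) : Perm (Fin (n + 1) × Fin (n + 1)) :=
  Equiv.prodCongrLeft fun j : Fin (n + 1) => (finRotate (n + 1)) ^ (n - (j : ℕ))

/-- The permutation of positions which sends each column to its matching row. -/
def matchPerm (n : ℕ) : Perm (Fin ((n + 1) * (n + 1))) :=
  finRotate _ * (colIndex n).permCongr (blockRotation n)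

/-- In positions, the matching shifts column (s, j) by -j if j < s and by n+1-j otherwise, the last
position wrapping round to the top row. Apart from a global shift by 1, this is rotation by -(j+1)
inside block j. -/
theorem matchPerm_colIndex (n : ℕ) (x : BlockCol n) :
    matchPerm n (colIndex n x) = rowIndex n (matchRow n x) := by
  obtain ⟨⟨s, hs⟩, ⟨j, hj⟩⟩ := x
  have hval : (matchPerm n (colIndex n (⟨s, hs⟩, ⟨j, hj⟩)) : ℕ)
      = ((s + (n - j)) % (n + 1) + (n + 1) * j + 1) % ((n + 1) * (n + 1)) := by
    rw [matchPerm, Perm.mul_apply, permCongr_apply, symm_apply_apply, finRotate_apply,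
      Fin.val_add, colIndex_val]
    simp [blockRotation, finRotate_pow_val]
  refine Fin.ext (hval.trans ?_)
  have hnj : (n + 1) * j ≤ (n + 1) * n := Nat.mul_le_mul_left _ (by omega)
  by_cases h : j < s
  · have h1 : (s + (n - j)) % (n + 1) = s - 1 - j := by
      rw [show s + (n - j) = (s - 1 - j) + (n + 1) by omega, Nat.add_mod_right,
        Nat.mod_eq_of_lt (by omega)]
    rw [matchRow_of_lt n _ _ h, h1, Nat.mod_eq_of_lt (by
      have h6 : (n + 1) * (n + 1) = (n + 1) * n + (n + 1) := by ring
      omega)]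
    simp only [rowIndex]
    have : (n + 1) * j = n * j + j := by ring
    omega
  · have h1 : (s + (n - j)) % (n + 1) = s + (n - j) := Nat.mod_eq_of_lt (by omega)
    rw [h1]
    by_cases h' : s = n
    · rw [matchRow_last n _ _ h h']
      have hjn : j = n := by omega
      have : s + (n - j) + (n + 1) * j + 1 = (n + 1) * (n + 1) := by
        subst h'; subst hjn; simp; ring
      rw [this, Nat.mod_self]
      rfl
    · rw [matchRow_of_ge n _ _ h h']
      have h2 : (n + 1) * j = n * j + j := by ring
      have h3 : n * (j + 1) = n * j + n := by ring
      have h4 := rowIndex_lt (n := n) (t := s) (p := j + 1) (by omega) (by omega)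
      simp only [rowIndex]
      rw [Nat.mod_eq_of_lt (by omega)]
      omega

theorem sign_matchPerm (n : ℕ) :
    Perm.sign (matchPerm n)
      = (-1) ^ ((n + 1) * (n + 1) - 1) * ((-1) ^ n) ^ (∑ j ∈ range (n + 1), j) := by
  rw [matchPerm, Perm.sign_mul, sign_finRotate, Perm.sign_permCongr, blockRotation,
    Perm.sign_prodCongrLeft]
  congr 1
  simp only [map_pow, sign_finRotate, Nat.add_sub_cancel]
  rw [Fin.prod_univ_eq_prod_range (fun k => (((-1) ^ n) ^ (n - k) : ℤˣ)) (n + 1),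
    ← prod_range_reflect, prod_pow_eq_pow_sum]
  congr 1
  refine sum_congr rfl fun j hj => ?_
  have := mem_range.1 hj
  omega

/-- The determinant of a matrix given by positions, through its structured form. -/
theorem det_submatrix_matchRow (n : ℕ)
    (A : Matrix (Fin ((n + 1) * (n + 1))) (Fin ((n + 1) * (n + 1))) R) :
    ((A.submatrix (rowIndex n) (colIndex n)).submatrix (matchRow n) id).det
      = ((Perm.sign (matchPerm n) : ℤˣ) : ℤ) * A.det := by
  rw [← Matrix.det_permute, ← Matrix.det_submatrix_equiv_self (colIndex n)
    (A.submatrix (matchPerm n) id)]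
  congr 1
  ext x y
  simp [matchPerm_colIndex]

theorem MXof_submatrix (k n : ℕ) (hn : n + 1 = 4 * k) (hq : (n + 1) * (n + 1) = 16 * k ^ 2)
    (hn0 : 0 < n) (X₁ X₂ Y : ℕ → R) :
    (((MXof k X₁ X₂ Y).submatrix (finCongr hq) (finCongr hq)).submatrix (rowIndex n)
        (colIndex n))
      = blockBidiagonal n (fun i => x R k (i + 1) (n + 1))
          (fun t i => f₁ k X₁ Y (t + 1) (4 * i * k + (t + 1)))
          (fun t i => g₁ X₁ Y (t + 1) (4 * i * k + (t + 1)))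
          (fun t i => f₀ k X₂ Y (t + 1) (4 * i * k + (t + 2)))
          (fun t i => g₀ X₂ Y (t + 1) (4 * i * k + (t + 2))) := by
  ext y ⟨s, i⟩
  have hs : (s : ℕ) < n + 1 := s.2
  have h1 : ((s : ℕ) + (n + 1) * i) / (n + 1) = i := by
    rw [Nat.add_mul_div_left _ _ (Nat.succ_pos n), Nat.div_eq_of_lt s.2, zero_add]
  have h2 : ((s : ℕ) + (n + 1) * i) % (n + 1) = s := by
    rw [Nat.add_mul_mod_self_left, Nat.mod_eq_of_lt s.2]
  rw [Matrix.submatrix_apply, Matrix.submatrix_apply]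
  rcases y with u | ⟨t, p⟩
  · simp only [MXof, rowIndex, finCongr_apply, Fin.val_cast, colIndex_val, ← hn, h1, h2,
      blockBidiagonal, if_true]
    split_ifs with hsn
    · rw [hsn]
    · rw [x, if_neg (by omega)]
  · have h3 : ((t : ℕ) + n * p) / n = p := by
      rw [Nat.add_mul_div_left _ _ hn0, Nat.div_eq_of_lt t.2, zero_add]
    have h4 : ((t : ℕ) + n * p) % n = t := by
      rw [Nat.add_mul_mod_self_left, Nat.mod_eq_of_lt t.2]
    have h5 : ¬ (1 + ((t : ℕ) + n * p) = 0) := by omega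
    simp only [MXof, rowIndex, finCongr_apply, Fin.val_cast, colIndex_val, ← hn, h1, h2, h3, h4,
      blockBidiagonal, if_neg h5, F, G, Nat.add_sub_cancel, Nat.add_sub_cancel_left,
      Nat.add_right_cancel_iff]
    by_cases hst : (s : ℕ) = t
    · simp [hst]
    · by_cases hst' : (s : ℕ) = t + 1
      · simp [hst', add_assoc]
      · simp [hst, hst']

end Reindexing

/-! ### Identification of the blocks with pencils -/

section Evaluation

open Polynomial Finset

theorem blockBidiagonal_congr {R : Type*} [CommRing R] (n : ℕ) {top top' : ℕ → R}
    {a₀ a₁ b₀ b₁ a₀' a₁' b₀' b₁' : ℕ → ℕ → R} (h : ∀ i < n + 1, top i = top' i)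
    (ha₀ : ∀ t < n, ∀ i < n + 1, a₀ t i = a₀' t i) (ha₁ : ∀ t < n, ∀ i < n + 1, a₁ t i = a₁' t i)
    (hb₀ : ∀ t < n, ∀ i < n + 1, b₀ t i = b₀' t i)
    (hb₁ : ∀ t < n, ∀ i < n + 1, b₁ t i = b₁' t i) :
    blockBidiagonal n top a₀ a₁ b₀ b₁ = blockBidiagonal n top' a₀' a₁' b₀' b₁' := by
  ext y ⟨s, i⟩
  rcases y with u | ⟨t, p⟩
  · simp only [blockBidiagonal, h i i.2]
  · simp only [blockBidiagonal, ha₀ t t.2 i i.2, ha₁ t t.2 i i.2, hb₀ t t.2 i i.2,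
      hb₁ t t.2 i i.2]

/-- The exponent n+1-t is 1 plus the number of pairs (t, b) with t ≤ b < n. Thus one factor is
available for each linear factor and one for each resultant factor. -/
theorem prod_pow_sub_eq {M : Type*} [CommMonoid M] (n : ℕ) (w : ℕ → M) :
    ∏ t ∈ range n, w t ^ (n + 1 - t)
      = (∏ t ∈ range n, w t) * ∏ t ∈ range n, ∏ a ∈ range (t + 1), w a := by
  induction n with
  | zero => simp
  | succ n ih =>
    have h : ∏ t ∈ range n, w t ^ (n + 1 + 1 - t)
        = (∏ t ∈ range n, w t ^ (n + 1 - t)) * ∏ t ∈ range n, w t := by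
      rw [← prod_mul_distrib]
      refine prod_congr rfl fun t ht => ?_
      rw [← pow_succ, show n + 1 - t + 1 = n + 1 + 1 - t by have := mem_range.1 ht; omega]
    rw [prod_range_succ, h, ih, prod_range_succ w, prod_range_succ (fun t => ∏ a ∈ _, w a),
      prod_range_succ w, show n + 1 + 1 - n = 2 by omega, pow_two]
    simp only [mul_assoc, mul_comm, mul_left_comm]

theorem prod_Icc_one_eq_prod_range {M : Type*} [CommMonoid M] (n : ℕ) (w : ℕ → M) :
    ∏ i ∈ Icc 1 n, w i = ∏ i ∈ range n, w (i + 1) := by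
  rw [range_eq_Ico, prod_Ico_add' w 0 n 1, zero_add]
  rfl

theorem prod_range_prod_range_succ {M : Type*} [CommMonoid M] (n : ℕ) (w : ℕ → ℕ → M) :
    ∏ t ∈ range n, ∏ a ∈ range (t + 1), w (a + 1) (t + 1)
      = ∏ a ∈ Icc 1 n, ∏ b ∈ Icc a n, w a b := by
  have h : ∏ a ∈ Icc 1 n, ∏ b ∈ Icc a n, w a b = ∏ b ∈ Icc 1 n, ∏ a ∈ Icc 1 b, w a b :=
    prod_comm' (by intro a b; simp only [mem_Icc]; omega)
  rw [h, prod_Icc_one_eq_prod_range]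
  exact prod_congr rfl fun t _ => (prod_Icc_one_eq_prod_range (t + 1) fun a => w a (t + 1)).symm

variable {K : Type*} [Field K] [CharZero K]

/-- At z = m - 1/m one has m(j+m+1-z) = m(j+1)+1 and -m(j-z) = m(m-j)-1. The evenness of m makes the
total sign independent of i. -/
theorem eval_kernelPolyDiff (m i : ℕ) (hm : Even m) (hm0 : m ≠ 0) (hi : i < m) :
    (kernelPolyDiff K m i).eval ((m : K) - 1 / m) * (-(m : K) ^ (m - 1))
      = (-1) ^ i * (∏ j ∈ Icc 1 (m - (i + 1)), ((m : K) * j - 1))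
          * ∏ j ∈ Icc 1 i, ((m : K) * j + 1) := by
  have hmK : (m : K) ≠ 0 := Nat.cast_ne_zero.2 hm0
  have h1 : ∏ j ∈ Icc 1 i, ((m : K) * j + 1)
      = (m : K) ^ i * ∏ j ∈ range i, ((j : K) + m + 1 - (m - 1 / m)) := by
    rw [prod_Icc_one_eq_prod_range]
    have h := pow_card_mul_prod (s := range i) (b := (m : K))
      (f := fun j : ℕ => (j : K) + m + 1 - (m - 1 / m))
    rw [card_range] at h
    rw [h]
    refine prod_congr rfl fun j _ => ?_
    push_cast
    field_simp
    ring
  have h2 : ∏ j ∈ Icc 1 (m - (i + 1)), ((m : K) * j - 1)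
      = (-(m : K)) ^ (m - (i + 1)) * ∏ j ∈ Ico (i + 1) m, ((j : K) - (m - 1 / m)) := by
    have h := pow_card_mul_prod (s := Ico (i + 1) m) (b := -(m : K))
      (f := fun j : ℕ => (j : K) - (m - 1 / m))
    rw [Nat.card_Ico] at h
    have h' := prod_Ico_reflect (fun j : ℕ => (m : K) * j - 1) (i + 1) (Nat.le_succ m)
    rw [Nat.add_sub_cancel_left, show m + 1 - (i + 1) = m - (i + 1) + 1 by omega] at h'
    rw [h]
    refine Eq.trans h'.symm (prod_congr rfl fun j hj => ?_)
    rw [Nat.cast_sub (mem_Ico.1 hj).2.le]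
    field_simp
    ring
  rw [h1, h2]
  simp only [kernelPolyDiff, eval_mul, eval_prod, eval_sub, eval_C, eval_X]
  have h3 : (-1 : K) ^ i * (-(m : K)) ^ (m - (i + 1)) * (m : K) ^ i = -(m : K) ^ (m - 1) := by
    rw [neg_pow (m : K), show m - 1 = m - (i + 1) + i by omega, pow_add]
    have : (-1 : K) ^ i * (-1) ^ (m - (i + 1)) = -1 := by
      rw [← pow_add, show i + (m - (i + 1)) = m - 1 by omega]
      exact Odd.neg_one_pow (Nat.Even.sub_odd (by omega) hm odd_one)
    linear_combination ((m : K) ^ (m - (i + 1)) * (m : K) ^ i) * this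
  rw [← h3]
  ring

/-- The node attached to the `t`-th position, and the evaluation point of the top row. -/
def node (n : ℕ) (X₁ Y : ℕ → K) (t : ℕ) : K :=
  if t = n then ((n + 1 : ℕ) : K) - 1 / (n + 1 : ℕ)
  else X₁ (t + 1) / ((n + 1 : ℕ) * Y (t + 1)) - (2 * t + 3) / (2 * (n + 1 : ℕ))

/-- The root of the superdiagonal block at the `t`-th position. -/
def superNode (n : ℕ) (X₂ Y : ℕ → K) (t : ℕ) : K :=
  X₂ (t + 1) / ((n + 1 : ℕ) * Y (t + 1)) - (t + 2) / (n + 1 : ℕ)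

/-- With 4ik = mi and N(k) = m(m+1), `f₁` and `g₁` have, as functions of i, roots that differ by
exactly m+1, and so do `f₀` and `g₀`. The first argument of `monomialMatrix` is the factor needed to
turn evaluation at m - 1/m into the row `x`. -/
theorem blockBidiagonal_eq_monomialMatrix (k n : ℕ) (hn : n + 1 = 4 * k) (X₁ X₂ Y : ℕ → K)
    (hY : ∀ t, Y t ≠ 0) :
    blockBidiagonal n (fun i => x K k (i + 1) (n + 1))
          (fun t i => f₁ k X₁ Y (t + 1) (4 * i * k + (t + 1)))
          (fun t i => g₁ X₁ Y (t + 1) (4 * i * k + (t + 1)))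
          (fun t i => f₀ k X₂ Y (t + 1) (4 * i * k + (t + 2)))
          (fun t i => g₀ X₂ Y (t + 1) (4 * i * k + (t + 2)))
      = monomialMatrix n
          (-(2 * (-4) ^ k * ((n + 1 : ℕ) + 1) * ((n + 1 : ℕ) : K) ^ (n + 1))) ((-4) ^ k)
          (node n X₁ Y) (superNode n X₂ Y) (fun t => 4 * (n + 1 : ℕ) * Y (t + 1))
          (fun t => -((n + 1 : ℕ) * Y (t + 1))) := by
  have hk : (k : K) ≠ 0 := Nat.cast_ne_zero.2 (by omega)
  have hm : ((n + 1 : ℕ) : K) = 4 * k := by rw [hn]; push_cast; ring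
  refine blockBidiagonal_congr n ?_ ?_ ?_ ?_ ?_
  · intro i hi
    have h := eval_kernelPolyDiff (K := K) (n + 1) i (by rw [hn, Nat.even_mul]; left; decide)
      (Nat.succ_ne_zero n) hi
    rw [x, if_pos hn, eval_mul, eval_C, node, if_pos rfl]
    rw [Nat.add_sub_cancel] at h
    have hA : ∏ j ∈ Icc 1 (4 * k - (i + 1)), (4 * (j : K) * k - 1)
        = ∏ j ∈ Icc 1 (n + 1 - (i + 1)), (((n + 1 : ℕ) : K) * j - 1) := by
      rw [hn]
      exact prod_congr rfl fun j _ => by push_cast; ring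
    have hB : ∏ j ∈ Icc 1 i, (4 * (j : K) * k + 1)
        = ∏ j ∈ Icc 1 i, (((n + 1 : ℕ) : K) * j + 1) := by
      rw [hn]
      exact prod_congr rfl fun j _ => by push_cast; ring
    have hc : (-4 : K) ^ ((i + 1 + 1) * k) = (-4) ^ k * ((-4) ^ k) ^ (i + 1) := by
      rw [← pow_mul, ← pow_add]; ring_nf
    rw [show i + 1 - 1 = i from rfl, hA, hB, hc, mul_assoc _ (∏ j ∈ _, _) (∏ j ∈ _, _)]
    rw [mul_assoc ((-1 : K) ^ i)] at h
    rw [pow_succ ((n + 1 : ℕ) : K) n]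
    have h8 : 8 * (k : K) * (4 * k + 1) = 2 * ((n + 1 : ℕ) : K) * ((n + 1 : ℕ) + 1) := by
      rw [hm]; ring
    rw [h8]
    linear_combination (-((-4) ^ k * ((-4) ^ k) ^ (i + 1)
      * (2 * ((n + 1 : ℕ) : K) * ((n + 1 : ℕ) + 1)))) * h
  · intro t ht i hi
    have hYt := hY (t + 1)
    simp only [f₁, node, if_neg ht.ne, hm, N]
    push_cast
    field_simp
    ring
  · intro t ht i hi
    have hYt := hY (t + 1)
    simp only [g₁, node, if_neg ht.ne, hm]
    push_cast
    field_simp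
    ring
  · intro t ht i hi
    have hYt := hY (t + 1)
    simp only [f₀, superNode, hm, N]
    push_cast
    field_simp
    ring
  · intro t ht i hi
    have hYt := hY (t + 1)
    simp only [g₀, superNode, hm]
    push_cast
    field_simp
    ring

end Evaluation

/-! ### Constants and the determinant over a field -/

section Constants

open Polynomial Finset

variable {K : Type*} [Field K]

theorem prod_ascFactorial_eq (m : ℕ) :
    ∏ i ∈ Icc 1 m, ((i + 1).ascFactorial (m - i + 1) : K)
      = ∏ i ∈ range m, ((i + 2).ascFactorial (m - i) : K) := by
  rw [prod_Icc_one_eq_prod_range]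
  refine prod_congr rfl fun i hi => ?_
  rw [show m - (i + 1) + 1 = m - i by have := mem_range.1 hi; omega]

theorem det_constant_eq (k n : ℕ) (hk : 1 ≤ k) (hn : n + 1 = 4 * k) :
    2 * (-4 : K) ^ k * (4 * (k : K)) ^ (n + 1) * (-2) ^ n * (2 * (4 * (k : K))) ^ (2 * k * n)
        * ((-4) ^ k) ^ (2 * k * (4 * k + 1))
      = (-1) ^ (k - 1) * 4 ^ (2 * k * (4 * k ^ 2 + 7 * k + 2))
        * (k : K) ^ (2 * k * (4 * k + 1)) := by
  have hodd : Odd n := by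
    rw [← Nat.not_even_iff_odd]
    intro h
    have h' : Even (n + 1) := by rw [hn, Nat.even_mul]; left; decide
    exact (Nat.even_add_one.1 h') h
  have h1 : (-2 : K) ^ n * 2 = -2 ^ (n + 1) := by rw [hodd.neg_pow, pow_succ]; ring
  -- The exponent is even, so the sign in the final formula comes only from the single factor (-4)^k
  -- and the odd power of -2.
  have h2 : ((-4 : K) ^ k) ^ (2 * k * (4 * k + 1)) = 4 ^ (2 * k ^ 2 * (4 * k + 1)) := by
    have he : Even (k * (2 * k * (4 * k + 1))) := by
      simp [Nat.even_mul]
    rw [← pow_mul, he.neg_pow]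
    congr 1
    ring
  have h3 : (-4 : K) ^ k = -((-1) ^ (k - 1) * 4 ^ k) := by
    obtain ⟨l, rfl⟩ := Nat.exists_eq_add_of_le' hk
    rw [Nat.add_sub_cancel, neg_pow, pow_succ (-1 : K)]
    ring
  have h4 : (2 * (4 * (k : K))) ^ (n + 1) * (2 * (4 * (k : K))) ^ (2 * k * n)
      = 4 ^ (3 * k * (4 * k + 1)) * (k : K) ^ (2 * k * (4 * k + 1)) := by
    have he : n + 1 + 2 * k * n = 2 * k * (4 * k + 1) := by
      obtain rfl : n = 4 * k - 1 := by omega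
      zify [(by omega : 1 ≤ 4 * k)]
      ring
    rw [← pow_add, he, ← mul_assoc, mul_pow]
    congr 1
    rw [show (2 : K) * 4 = 2 ^ 3 by norm_num, show (4 : K) = 2 ^ 2 by norm_num, ← pow_mul,
      ← pow_mul]
    congr 1
    ring
  have h5 : (4 : K) ^ (2 * k * (4 * k ^ 2 + 7 * k + 2))
      = 4 ^ k * 4 ^ (3 * k * (4 * k + 1)) * 4 ^ (2 * k ^ 2 * (4 * k + 1)) := by
    rw [← pow_add, ← pow_add]
    congr 1
    ring
  rw [h2, h5]
  calc _ = (-4 : K) ^ k * ((-2 : K) ^ n * 2) * (4 * (k : K)) ^ (n + 1)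
        * (2 * (4 * (k : K))) ^ (2 * k * n) * 4 ^ (2 * k ^ 2 * (4 * k + 1)) := by ring
    _ = (-1) ^ (k - 1) * 4 ^ k * ((2 * (4 * (k : K))) ^ (n + 1) * (2 * (4 * (k : K))) ^ (2 * k * n))
        * 4 ^ (2 * k ^ 2 * (4 * k + 1)) := by
      rw [h1, h3, mul_pow 2 (4 * (k : K)) (n + 1)]; ring
    _ = _ := by rw [h4]; ring

variable [CharZero K]

theorem prod_Ico_eq_ascFactorial (m i : ℕ) (hi : i < m) :
    ∏ j ∈ Ico i m, ((i : K) + m + 1 - j) = ((i + 2).ascFactorial (m - i) : K) := by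
  have h1 := prod_factorial_quotient (K := K) m i i hi.le
  have h2 := Nat.factorial_mul_ascFactorial (i + 1) (m - i)
  have h3 : ((i + 1).factorial : K) ≠ 0 := Nat.cast_ne_zero.2 (Nat.factorial_ne_zero _)
  apply mul_right_cancel₀ h3
  rw [h1, ← h2]
  push_cast
  ring

theorem prod_Ico_succ_bot (m i : ℕ) (hi : i < m) :
    ((m : K) + 1) * ∏ j ∈ Ico (i + 1) m, ((i : K) + m + 1 - j)
      = ((i + 2).ascFactorial (m - i) : K) := by
  rw [← prod_Ico_eq_ascFactorial m i hi, prod_eq_prod_Ico_succ_bot hi]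
  ring

theorem det_newtonMatrix_kernelPoly_eq (r : ℕ → K) (m : ℕ) (hm : Even m) (c : K) :
    (newtonMatrix r (m + 1) fun i => C (c ^ i) * kernelPoly K m i).det
      = c ^ (∑ i ∈ range (m + 1), i)
        * ∏ i ∈ Icc 1 m, ((i + 1).ascFactorial (m - i + 1) : K) := by
  rw [det_newtonMatrix_kernelPoly, prod_mul_distrib, prod_ascFactorial_eq]
  simp only [hm.neg_one_pow, mul_one]
  rw [prod_pow_eq_pow_sum, prod_range_succ _ m, Ico_self, prod_empty, mul_one]
  congr 1
  exact prod_congr rfl fun i hi => prod_Ico_eq_ascFactorial m i (mem_range.1 hi)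

/-- Each diagonal entry lacks the factor j = i, which equals m+1. The m extra factors restore it,
and the right-hand side becomes that of `det_newtonMatrix_kernelPoly_eq`. -/
theorem det_newtonMatrix_kernelPolyDiff_eq (r : ℕ → K) (m : ℕ) (hm : Even m) (c : K) :
    ((m : K) + 1) ^ m
        * (newtonMatrix r m fun i => C (c ^ (i + 1)) * kernelPolyDiff K m i).det
      = c ^ (∑ i ∈ range (m + 1), i)
        * ∏ i ∈ Icc 1 m, ((i + 1).ascFactorial (m - i + 1) : K) := by
  rw [det_newtonMatrix_kernelPolyDiff, prod_mul_distrib, prod_mul_distrib, prod_const,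
    card_range, ← pow_mul, mul_comm (m - 1) m, (hm.mul_right _).neg_one_pow, mul_one,
    prod_pow_eq_pow_sum, sum_range_succ', add_zero, mul_left_comm, prod_ascFactorial_eq]
  congr 1
  have h := pow_card_mul_prod (s := range m) (b := (m : K) + 1)
    (f := fun i : ℕ => ∏ j ∈ Ico (i + 1) m, ((i : K) + m + 1 - j))
  rw [card_range] at h
  rw [h]
  exact prod_congr rfl fun i hi => prod_Ico_succ_bot m i (mem_range.1 hi)

theorem sum_range_eq (k : ℕ) : ∑ i ∈ range (4 * k + 1), i = 2 * k * (4 * k + 1) := by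
  have h := sum_range_id_mul_two (4 * k + 1)
  rw [Nat.add_sub_cancel] at h
  nlinarith

theorem sum_range_eq' (k n : ℕ) (hn : n + 1 = 4 * k) : ∑ i ∈ range (n + 1), i = 2 * k * n := by
  have h := sum_range_id_mul_two (n + 1)
  rw [Nat.add_sub_cancel, hn] at h
  rw [hn]
  nlinarith

theorem sign_matchPerm_eq (k n : ℕ) (hn : n + 1 = 4 * k) :
    Equiv.Perm.sign (matchPerm n) = -1 := by
  have hq : Odd ((n + 1) * (n + 1) - 1) := by
    refine Nat.Even.sub_odd (Nat.succ_le_of_lt (by positivity)) ?_ odd_one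
    rw [hn, Nat.even_mul, Nat.even_mul]
    left; left; decide
  rw [sign_matchPerm, sum_range_eq' k n hn, hq.neg_one_pow, ← pow_mul,
    Even.neg_one_pow, mul_one]
  rw [Nat.even_mul, Nat.even_mul, Nat.even_mul]
  right; left; left; decide

/-- The linear factor contributed by the evaluation of the top row. -/
def linearFactor {R : Type*} [CommRing R] (k : ℕ) (X₁ Y : ℕ → R) (a : ℕ) : R :=
  2 * X₁ a - (32 * (k : R) ^ 2 + 2 * (a : R) - 1) * Y a

/-- The resultant factor of a diagonal and a superdiagonal block. -/
def resultantFactor {R : Type*} [CommRing R] (X₁ X₂ Y : ℕ → R) (a b : ℕ) : R :=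
  2 * X₂ b * Y a - 2 * X₁ a * Y b - (2 * (b : R) - 2 * (a : R) + 1) * Y a * Y b

/-- Each difference of nodes is cleared of denominators by a suitable Y: one Y_a for a linear
factor, and Y_a Y_b for a resultant factor. `prod_pow_sub_eq` distributes the powers accordingly. -/
theorem newton_side_eq (k n : ℕ) (hn : n + 1 = 4 * k) (X₁ X₂ Y : ℕ → K) (hY : ∀ t, Y t ≠ 0) :
    (∏ b ∈ range n, (node n X₁ Y n - node n X₁ Y b))
        * ∏ t ∈ range n, ((4 * ((n + 1 : ℕ) : K) * Y (t + 1) * ((n + 1 : ℕ) + 1)) ^ (n + 1 - t)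
            * ∏ a ∈ range (t + 1), (-(((n + 1 : ℕ) : K) * Y (t + 1)) * ((n + 1 : ℕ) + 1)
                * (node n X₁ Y a - superNode n X₂ Y t)))
      = (-(2 * (((n + 1 : ℕ) : K) + 1))) ^ n
          * (2 * ((n + 1 : ℕ) : K) * (((n + 1 : ℕ) : K) + 1) ^ 2) ^ (2 * k * n)
          * (∏ a ∈ Icc 1 n, linearFactor k X₁ Y a)
          * ∏ a ∈ Icc 1 n, ∏ b ∈ Icc a n, resultantFactor X₁ X₂ Y a b := by
  have hk : (k : K) ≠ 0 := Nat.cast_ne_zero.2 (by omega)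
  have hm : ((n + 1 : ℕ) : K) = 4 * k := by rw [hn]; push_cast; ring
  rw [prod_mul_distrib, prod_pow_sub_eq n fun t => 4 * ((n + 1 : ℕ) : K) * Y (t + 1)
    * ((n + 1 : ℕ) + 1), mul_assoc (∏ t ∈ range n, _), ← mul_assoc, ← prod_mul_distrib,
    ← prod_mul_distrib]
  have h1 : ∏ b ∈ range n, ((node n X₁ Y n - node n X₁ Y b)
        * (4 * ((n + 1 : ℕ) : K) * Y (b + 1) * ((n + 1 : ℕ) + 1)))
      = (-(2 * (((n + 1 : ℕ) : K) + 1))) ^ n * ∏ a ∈ Icc 1 n, linearFactor k X₁ Y a := by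
    have h := pow_card_mul_prod (s := range n) (b := -(2 * (((n + 1 : ℕ) : K) + 1)))
      (f := fun b => linearFactor k X₁ Y (b + 1))
    rw [card_range] at h
    rw [prod_Icc_one_eq_prod_range, h]
    refine prod_congr rfl fun b hb => ?_
    have hYb := hY (b + 1)
    simp only [node, if_true, if_neg (mem_range.1 hb).ne, hm, linearFactor]
    push_cast
    field_simp
    ring
  have h2 : ∏ t ∈ range n, ((∏ a ∈ range (t + 1), 4 * ((n + 1 : ℕ) : K) * Y (a + 1)
          * ((n + 1 : ℕ) + 1))
        * ∏ a ∈ range (t + 1), (-(((n + 1 : ℕ) : K) * Y (t + 1)) * ((n + 1 : ℕ) + 1)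
                * (node n X₁ Y a - superNode n X₂ Y t)))
      = (2 * ((n + 1 : ℕ) : K) * (((n + 1 : ℕ) : K) + 1) ^ 2) ^ (2 * k * n)
          * ∏ a ∈ Icc 1 n, ∏ b ∈ Icc a n, resultantFactor X₁ X₂ Y a b := by
    have hs : ∑ t ∈ range n, (t + 1) = 2 * k * n := by
      rw [← sum_range_eq' k n hn, sum_range_succ', add_zero]
    rw [← hs, ← prod_pow_eq_pow_sum, ← prod_range_prod_range_succ, ← prod_mul_distrib]
    refine prod_congr rfl fun t ht => ?_
    have h := pow_card_mul_prod (s := range (t + 1))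
      (b := 2 * ((n + 1 : ℕ) : K) * (((n + 1 : ℕ) : K) + 1) ^ 2)
      (f := fun a => resultantFactor X₁ X₂ Y (a + 1) (t + 1))
    rw [card_range] at h
    rw [h, ← prod_mul_distrib]
    refine prod_congr rfl fun a ha => ?_
    have hYa := hY (a + 1)
    have hYt := hY (t + 1)
    have hta := mem_range.1 ht
    have han := mem_range.1 ha
    simp only [node, superNode, if_neg (show a ≠ n by omega), hm, resultantFactor]
    push_cast
    field_simp
    ring
  rw [h1, h2]
  ring

theorem det_MXof_of_ne_zero (k : ℕ) (hk : 1 ≤ k) (X₁ X₂ Y : ℕ → K) (hY : ∀ t, Y t ≠ 0) :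
    (MXof k X₁ X₂ Y).det =
      (-1) ^ (k - 1) * 4 ^ (2 * k * (4 * k ^ 2 + 7 * k + 2)) * (k : K) ^ (2 * k * (4 * k + 1))
        * (∏ i ∈ Icc 1 (4 * k), ((i + 1).ascFactorial (4 * k - i + 1) : K))
        * (∏ a ∈ Icc 1 (4 * k - 1), linearFactor k X₁ Y a)
        * (∏ a ∈ Icc 1 (4 * k - 1), ∏ b ∈ Icc a (4 * k - 1), resultantFactor X₁ X₂ Y a b) := by
  obtain ⟨n, hn⟩ : ∃ n, n + 1 = 4 * k := ⟨4 * k - 1, by omega⟩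
  have hn' : 4 * k - 1 = n := by omega
  have hq : (n + 1) * (n + 1) = 16 * k ^ 2 := by rw [hn]; ring
  have hm : ((n + 1 : ℕ) : K) = 4 * k := by rw [hn]; push_cast; ring
  have heven : Even (n + 1) := by rw [hn, Nat.even_mul]; left; decide
  have hD := det_submatrix_matchRow n
    ((MXof k X₁ X₂ Y).submatrix (finCongr hq) (finCongr hq))
  rw [MXof_submatrix k n hn hq (by omega), blockBidiagonal_eq_monomialMatrix k n hn X₁ X₂ Y hY,
    Matrix.det_submatrix_equiv_self, sign_matchPerm_eq k n hn] at hD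
  have hM := det_monomialMatrix_mul n
    (-(2 * (-4) ^ k * ((n + 1 : ℕ) + 1) * ((n + 1 : ℕ) : K) ^ (n + 1))) ((-4) ^ k)
    (node n X₁ Y) (superNode n X₂ Y) (fun t => 4 * (n + 1 : ℕ) * Y (t + 1))
    (fun t => -((n + 1 : ℕ) * Y (t + 1)))
  have hΨ := det_newtonMatrix_kernelPoly_eq (node n X₁ Y) (n + 1) heven ((-4) ^ k)
  have hΦ := det_newtonMatrix_kernelPolyDiff_eq (node n X₁ Y) (n + 1) heven ((-4) ^ k)
  rw [hD, mul_assoc (-(_ : K)), newton_side_eq k n hn X₁ X₂ Y hY, hΨ] at hM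
  have hP0 : (∏ i ∈ Icc 1 (n + 1), ((i + 1).ascFactorial (n + 1 - i + 1) : K)) ≠ 0 :=
    prod_ne_zero_iff.2 fun i _ => Nat.cast_ne_zero.2 (Nat.ascFactorial_pos _ _).ne'
  rw [hn', ← hn]
  generalize (∏ i ∈ Icc 1 (n + 1), ((i + 1).ascFactorial (n + 1 - i + 1) : K)) = P at *
  generalize (newtonMatrix (node n X₁ Y) (n + 1)
    fun i => C (((-4 : K) ^ k) ^ (i + 1)) * kernelPolyDiff K (n + 1) i).det = Φ at *
  generalize ∏ a ∈ Icc 1 n, linearFactor k X₁ Y a = L at *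
  generalize ∏ a ∈ Icc 1 n, ∏ b ∈ Icc a n, resultantFactor X₁ X₂ Y a b = Q at *
  have hconst := det_constant_eq (K := K) k n hk hn
  rw [show ∑ i ∈ range (n + 1 + 1), i = 2 * k * (n + 1 + 1) by rw [hn, sum_range_eq]] at hM hΦ
  rw [← hn, ← hm] at hconst
  rw [Units.val_neg, Units.val_one, Int.cast_neg, Int.cast_one] at hM
  have hγ : ((-4 : K) ^ k) ^ (2 * k * (n + 1 + 1)) ≠ 0 := by simp
  generalize ((-4 : K) ^ k) ^ (2 * k * (n + 1 + 1)) = γ at *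
  rw [← hconst]
  generalize (((n + 1 : ℕ) : K)) = q at *
  generalize (MXof k X₁ X₂ Y).det = D at *
  -- The powers of m+1 match: one from the top row, n from the linear factors, and two from each of
  -- the 2kn resultant factors.
  have hu : (q + 1) ^ ((n + 1) * (n + 1)) = (q + 1) * (q + 1) ^ n * ((q + 1) ^ 2) ^ (2 * k * n) := by
    rw [← pow_succ', ← pow_mul, ← pow_add]
    congr 1
    linear_combination n * hn
  have hΦ' : (q + 1) * (q + 1) ^ n * ((q + 1) ^ 2) ^ (2 * k * n) * Φ ^ (n + 1)
      = (γ * P) ^ (n + 1) := by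
    rw [← hu, pow_mul, ← mul_pow, hΦ]
  have hM' : (-(2 * (q + 1))) ^ n * (2 * q * (q + 1) ^ 2) ^ (2 * k * n)
      = (-2) ^ n * (q + 1) ^ n * ((2 * q) ^ (2 * k * n) * ((q + 1) ^ 2) ^ (2 * k * n)) := by
    rw [← mul_pow, ← mul_pow]
    ring
  -- The row change contributes the power n of γP and the column change the power n+1, so a single
  -- γP survives the cancellation.
  have hne : (γ * P) ^ n ≠ 0 := pow_ne_zero _ (mul_ne_zero hγ hP0)
  apply mul_left_cancel₀ hne
  rw [hM'] at hM
  rw [pow_succ (γ * P)] at hΦ'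
  linear_combination (-1 : K) * hM + (2 * (-4) ^ k * q ^ (n + 1) * (-2) ^ n * (2 * q) ^ (2 * k * n) * L * Q) * hΦ'

end Constants

/-! ### The polynomial identity and its specialisation -/

section Specialisation

open Finset

theorem MXof_map {R S : Type*} [CommRing R] [CommRing S] (φ : R →+* S) (k : ℕ)
    (X₁ X₂ Y : ℕ → R) :
    (MXof k X₁ X₂ Y).map φ
      = MXof k (fun t => φ (X₁ t)) (fun t => φ (X₂ t)) (fun t => φ (Y t)) := by
  ext r c
  simp only [Matrix.map_apply, MXof, x, F, G, f₀, f₁, g₀, g₁]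
  split_ifs <;> simp [map_ofNat φ]

theorem det_MX (k : ℕ) (hk : 1 ≤ k) :
    (MX k).det =
      (-1) ^ (k - 1) * 4 ^ (2 * k * (4 * k ^ 2 + 7 * k + 2))
        * (k : MvPolynomial Var ℤ) ^ (2 * k * (4 * k + 1))
        * (∏ i ∈ Icc 1 (4 * k), ((i + 1).ascFactorial (4 * k - i + 1) : MvPolynomial Var ℤ))
        * (∏ a ∈ Icc 1 (4 * k - 1), linearFactor k X₁ Y a)
        * (∏ a ∈ Icc 1 (4 * k - 1), ∏ b ∈ Icc a (4 * k - 1), resultantFactor X₁ X₂ Y a b) := by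
  let K := FractionRing (MvPolynomial Var ℤ)
  let φ : MvPolynomial Var ℤ →+* K := algebraMap _ _
  have hφ : Function.Injective φ := IsFractionRing.injective _ _
  have : CharZero K := charZero_of_injective_ringHom hφ
  have hY : ∀ t, φ (Y t) ≠ 0 := fun t =>
    (map_ne_zero_iff φ hφ).2 (MvPolynomial.X_ne_zero _)
  apply hφ
  have h := det_MXof_of_ne_zero k hk (fun t => φ (X₁ t)) (fun t => φ (X₂ t)) (fun t => φ (Y t)) hY
  rw [RingHom.map_det, RingHom.mapMatrix_apply, MX, MXof_map, h]
  simp only [linearFactor, resultantFactor, map_mul, map_pow, map_prod, map_sub, map_add,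
    map_neg, map_one, map_natCast, map_ofNat]

theorem det_specialised_ne_zero (k : ℕ) (hk : 1 ≤ k) :
    ((MX k).map (MvPolynomial.eval (special k))).det ≠ 0 := by
  rw [← RingHom.mapMatrix_apply, ← RingHom.map_det, det_MX k hk]
  simp only [linearFactor, resultantFactor, map_mul, map_pow, map_prod, map_sub, map_add,
    map_neg, map_one, map_natCast, map_ofNat, X₁, X₂, Y, MvPolynomial.eval_X, special]
  have hk0 : (k : ℤ) ≠ 0 := by exact_mod_cast (by omega : k ≠ 0)
  refine mul_ne_zero (mul_ne_zero (mul_ne_zero (mul_ne_zero (mul_ne_zero ?_ ?_) ?_) ?_) ?_) ?_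
  · simp
  · simp
  · exact pow_ne_zero _ hk0
  · exact prod_ne_zero_iff.2 fun i _ => Nat.cast_ne_zero.2 (Nat.ascFactorial_pos _ _).ne'
  · refine prod_ne_zero_iff.2 fun a ha => ?_
    have := (mem_Icc.1 ha).2
    -- Since 2N(k) = 32k² + 8k, the linear factor becomes an odd integer; the resultant factors
    -- below are odd as well.
    have h : (2 * (N k : ℤ) - (32 * (k : ℤ) ^ 2 + 2 * a - 1) * 1) = 8 * k - 2 * a + 1 := by
      simp only [N]; push_cast; ring
    rw [h]
    omega
  · refine prod_ne_zero_iff.2 fun a _ => prod_ne_zero_iff.2 fun b hb => ?_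
    have := (mem_Icc.1 hb).1
    intro h
    have h' : (2 * b - 2 * a + 1 : ℤ) = 0 := by linear_combination -h
    omega

theorem det_MXof_rat_ne_zero (k : ℕ) (hk : 1 ≤ k) :
    (MXof k (fun _ => (N k : ℚ)) (fun _ => (N k : ℚ)) (fun _ => 1)).det ≠ 0 := by
  have h := det_specialised_ne_zero k hk
  rw [MX, MXof_map] at h
  have h' := (map_ne_zero_iff (Int.castRingHom ℚ) Int.cast_injective).2 h
  rw [RingHom.map_det, RingHom.mapMatrix_apply, MXof_map] at h'
  simpa [X₁, X₂, Y, special] using h'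

end Specialisation

/-! ### The rows of M as linear equations -/

section CoefficientMatrix

open Finset

/-- The `i`-th entry of the matrix `U` applied to a vector `w` supported on `1, …, N - 1`. -/
def uRow (k : ℕ) (w : ℕ → ℚ) (i : ℕ) : ℚ :=
  (i : ℚ) * (-4) ^ k * w i + -(4 * ((i - 1 : ℕ) : ℚ) + 2) * (-4) ^ k * w (i - 1)
    + ((N k : ℚ) - ((i - 4 * k : ℕ) : ℚ)) * w (i - 4 * k)
    + -(4 * (N k : ℚ) - 4 * ((i - (4 * k + 1) : ℕ) : ℚ) - 2) * w (i - (4 * k + 1))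

/-- The vanishing at 0 absorbs truncated subtraction: if i ≤ d no summand is selected, and `h (i -
d)` is `h 0`. -/
theorem sum_shifted_indicator (n i d : ℕ) (h : ℕ → ℚ) (hw : ∀ j, j = 0 ∨ n + 1 ≤ j → h j = 0) :
    ∑ j ∈ range n, (if i = j + 1 + d then h (j + 1) else 0) = h (i - d) := by
  by_cases hi : 1 ≤ i - d ∧ i - d < n + 1
  · rw [sum_eq_single (i - d - 1)]
    · rw [if_pos (by omega), show i - d - 1 + 1 = i - d by omega]
    · intro j _ hj
      rw [if_neg (by omega)]
    · intro hn
      rw [mem_range] at hn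
      omega
  · rw [hw (i - d) (by omega)]
    refine sum_eq_zero fun j hj => if_neg ?_
    rw [mem_range] at hj
    omega

theorem M_mulVec_top (k : ℕ) (hk : 1 ≤ k) (w : ℕ → ℚ) (r : Fin (N k + 4 * k + 1))
    (hr : (r : ℕ) = 0) :
    (M k).mulVec (fun c => w (c + 1)) r = ∑ p ∈ range (4 * k + 2), y k p * w (N k + p) := by
  have hN : 1 ≤ N k := by unfold N; nlinarith
  simp only [Matrix.mulVec, dotProduct, M, if_pos hr]
  rw [Fin.sum_univ_eq_sum_range
    (fun c => (if c + 1 < N k then 0 else y k (c + 1 - N k)) * w (c + 1)),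
    show N k + 4 * k + 1 = (N k - 1) + (4 * k + 2) by omega, sum_range_add, sum_eq_zero, zero_add]
  · refine sum_congr rfl fun p _ => ?_
    rw [if_neg (by omega), show N k - 1 + p + 1 = N k + p by omega, Nat.add_sub_cancel_left]
  · intro c hc
    rw [mem_range] at hc
    rw [if_pos (by omega), zero_mul]

theorem M_mulVec_pos (k : ℕ) (hk : 1 ≤ k) (w : ℕ → ℚ) (r : Fin (N k + 4 * k + 1))
    (hr : (r : ℕ) ≠ 0) :
    (M k).mulVec (fun c => w (c + 1)) r
      = uRow k (fun j => if 1 ≤ j ∧ j < N k then w j else 0) r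
        + ∑ p ∈ range (4 * k + 2),
            if (r : ℕ) = 4 * p * k + 1 then ((-4) ^ (p * k))⁻¹ * w (N k + p) else 0 := by
  have hN : 1 ≤ N k := by unfold N; nlinarith
  generalize hi : (r : ℕ) = i at hr
  simp only [Matrix.mulVec, dotProduct, M, hi, if_neg hr]
  rw [Fin.sum_univ_eq_sum_range
    (fun c => (if c + 1 < N k then
      if i = c + 1 then ((c + 1 : ℕ) : ℚ) * (-4) ^ k
      else if i = c + 1 + 1 then -(4 * ((c + 1 : ℕ) : ℚ) + 2) * (-4) ^ k
      else if i = c + 1 + 4 * k then (N k : ℚ) - ((c + 1 : ℕ) : ℚ)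
      else if i = c + 1 + 4 * k + 1 then -(4 * (N k : ℚ) - 4 * ((c + 1 : ℕ) : ℚ) - 2)
      else 0
      else if i = 4 * (c + 1 - N k) * k + 1 then ((-4) ^ ((c + 1 - N k) * k))⁻¹ else 0)
        * w (c + 1)),
    show N k + 4 * k + 1 = (N k - 1) + (4 * k + 2) by omega, sum_range_add]
  congr 1
  · set w' : ℕ → ℚ := fun j => if 1 ≤ j ∧ j < N k then w j else 0 with hw'
    have hzero : ∀ j, j = 0 ∨ N k - 1 + 1 ≤ j → w' j = 0 := fun j hj => by
      simp only [hw']; rw [if_neg (by omega)]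
    have hs := fun (d : ℕ) (g : ℕ → ℚ) => sum_shifted_indicator (N k - 1) i d
      (fun j => g j * w' j) (fun j hj => by rw [hzero j hj, mul_zero])
    have hs₀ : _ = (i : ℚ) * (-4) ^ k * w' i := hs 0 fun j => (j : ℚ) * (-4) ^ k
    rw [uRow, ← hs₀,
      ← hs 1 fun j => -(4 * (j : ℚ) + 2) * (-4) ^ k,
      ← hs (4 * k) fun j => (N k : ℚ) - (j : ℚ),
      ← hs (4 * k + 1) fun j => -(4 * (N k : ℚ) - 4 * (j : ℚ) - 2),
      ← sum_add_distrib, ← sum_add_distrib, ← sum_add_distrib]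
    refine sum_congr rfl fun c hc => ?_
    rw [mem_range] at hc
    have hwc : w' (c + 1) = w (c + 1) := by simp only [hw']; rw [if_pos (by omega)]
    rw [if_pos (by omega), hwc, add_zero, ← add_assoc (c + 1) (4 * k) 1]
    by_cases h1 : i = c + 1
    · rw [if_pos h1, if_pos h1, if_neg (by omega), if_neg (by omega), if_neg (by omega)]
      ring
    · by_cases h2 : i = c + 1 + 1
      · rw [if_neg h1, if_pos h2, if_neg h1, if_pos h2, if_neg (by omega), if_neg (by omega)]
        ring
      · by_cases h3 : i = c + 1 + 4 * k
        · rw [if_neg h1, if_neg h2, if_pos h3, if_neg h1, if_neg h2, if_pos h3,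
            if_neg (by omega)]
          ring
        · simp only [if_neg h1, if_neg h2, if_neg h3]
          split_ifs <;> ring
  · refine sum_congr rfl fun p _ => ?_
    rw [if_neg (by omega), show N k - 1 + p + 1 = N k + p by omega, Nat.add_sub_cancel_left]
    split_ifs <;> ring

end CoefficientMatrix

/-! ### Reduction of M to the specialised block matrix -/

section Nonsingular

open Finset

/-- N(k) - 4qk - 1 = (4k-q)(4k+1) - 1 + q - (4k-q) reduces to 4k(4k+1-q) - 1, the top factor of the
first product in `y k q`. The factor 4qk+1 is what the second product gains, and the signs
alternate. -/
theorem y_succ_relation (k q : ℕ) (hq : q ≤ 4 * k) :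
    (4 * (q : ℚ) * k + 1) * y k q + ((N k : ℚ) - 4 * q * k - 1) * y k (q + 1) = 0 := by
  obtain ⟨d, hd⟩ := Nat.exists_eq_add_of_le hq
  have hN : (N k : ℚ) = 4 * k * (4 * k + 1) := by rw [N]; push_cast; ring
  have hdk : (d : ℚ) = 4 * k - q := by
    rw [eq_sub_iff_add_eq, add_comm]
    exact_mod_cast hd.symm
  rw [y, y, show 4 * k + 1 - q = d + 1 by omega, show 4 * k + 1 - (q + 1) = d by omega,
    prod_Icc_succ_top (Nat.succ_le_succ (Nat.zero_le d))]
  rcases q with _ | p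
  · simp only [hN, Nat.cast_add, hdk, Icc_eq_empty_of_lt one_pos, prod_empty, zero_add,
      Nat.sub_self, Nat.zero_sub]
    push_cast
    ring
  · rw [Nat.add_sub_cancel, Nat.add_sub_cancel,
      prod_Icc_succ_top (Nat.succ_le_succ (Nat.zero_le p)), hN]
    rw [pow_succ (-1 : ℚ) (p + 1), Nat.cast_add d 1, hdk]
    push_cast
    ring

theorem x_eq_y_sub (k p : ℕ) (hp : p < 4 * k) :
    x ℚ k (p + 1) (4 * k)
      = -2 * ((-4) ^ k) ^ (p + 2) * (y k (p + 1) - y k (p + 2)) := by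
  obtain ⟨d, hd⟩ := Nat.exists_eq_add_of_le (Nat.succ_le_of_lt hp)
  have hk : (4 * k : ℚ) = p + 1 + d := by exact_mod_cast hd
  rw [x, if_pos rfl, y, y, show 4 * k + 1 - (p + 1) = d + 1 by omega,
    show 4 * k + 1 - (p + 2) = d by omega, show 4 * k - (p + 1) = d by omega,
    prod_Icc_succ_top (Nat.succ_le_succ (Nat.zero_le d)), Nat.add_sub_cancel,
    show p + 2 - 1 = p + 1 by omega, prod_Icc_succ_top (Nat.succ_le_succ (Nat.zero_le p)),
    ← pow_mul, show (p + 1 + 1) * k = k * (p + 2) by ring]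
  push_cast
  rw [pow_succ (-1 : ℚ) (p + 1), pow_succ (-1 : ℚ) p]
  linear_combination (2 * (4 * (k : ℚ)) * (-1) ^ p * (-4) ^ (k * (p + 2))
    * (∏ i ∈ Icc 1 d, (4 * (i : ℚ) * k - 1)) * ∏ i ∈ Icc 1 p, (4 * (i : ℚ) * k + 1)) * hk

/-- The coordinate 4qk+1 occurs in the rows numbered q and q+1, and `y_succ_relation` cancels it. On
the coordinate 4qk the same relation leaves only 2c^(q+1)(y_q - y_(q+1)), c = (-4)^k, which is an
entry of `x` up to sign. -/
theorem sum_y_mul_uRow (k : ℕ) (hk : 1 ≤ k) (w : ℕ → ℚ) (h0 : w 0 = 0)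
    (hw : ∀ j, 16 * k ^ 2 < j → w j = 0) :
    ∑ q ∈ range (4 * k + 2), y k q * ((-4) ^ k) ^ q * uRow k w (4 * q * k + 1)
      = -∑ p ∈ range (4 * k), x ℚ k (p + 1) (4 * k) * w (4 * (p + 1) * k) := by
  set a : ℕ → ℚ := fun q => y k q * ((-4) ^ k) ^ (q + 1)
    * ((4 * (q : ℚ) * k + 1) * w (4 * q * k + 1) - (4 * (4 * (q : ℚ) * k) + 2) * w (4 * q * k))
    with ha
  set b : ℕ → ℚ := fun q => y k (q + 1) * ((-4) ^ k) ^ (q + 1)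
    * (((N k : ℚ) - 4 * q * k - 1) * w (4 * q * k + 1)
      - (4 * (N k : ℚ) - 4 * (4 * (q : ℚ) * k) - 2) * w (4 * q * k)) with hb
  have hterm0 : y k 0 * ((-4) ^ k) ^ 0 * uRow k w (4 * 0 * k + 1) = a 0 := by
    simp [ha, uRow, h0, Nat.sub_eq_zero_of_le (show 1 ≤ 4 * k by omega)]
    ring
  have hterm : ∀ q, y k (q + 1) * ((-4) ^ k) ^ (q + 1) * uRow k w (4 * (q + 1) * k + 1)
      = a (q + 1) + b q := by
    intro q
    have h1 : 4 * (q + 1) * k + 1 - 4 * k = 4 * q * k + 1 := by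
      rw [show 4 * (q + 1) * k + 1 = 4 * q * k + 1 + 4 * k by ring, Nat.add_sub_cancel]
    have h2 : 4 * (q + 1) * k + 1 - (4 * k + 1) = 4 * q * k := by
      rw [show 4 * (q + 1) * k + 1 = 4 * q * k + (4 * k + 1) by ring, Nat.add_sub_cancel]
    simp only [ha, hb, uRow, h1, h2, Nat.add_sub_cancel]
    push_cast
    ring
  -- The coordinates involved are N(k) and N(k)+1, beyond the support of w.
  have hlast : a (4 * k + 1) = 0 := by
    have h1 : 16 * k ^ 2 < 4 * (4 * k + 1) * k := by nlinarith
    simp only [ha]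
    rw [hw _ h1, hw _ (h1.trans (Nat.lt_succ_self _))]
    ring
  have hab : ∀ q, q ≤ 4 * k → a q + b q
      = 2 * ((-4) ^ k) ^ (q + 1) * (y k q - y k (q + 1)) * w (4 * q * k) := by
    intro q hq
    simp only [ha, hb]
    linear_combination (((-4 : ℚ) ^ k) ^ (q + 1) * (w (4 * q * k + 1) - 4 * w (4 * q * k)))
      * y_succ_relation k q hq
  rw [sum_range_succ' _ (4 * k + 1), hterm0, sum_congr rfl fun q _ => hterm q, sum_add_distrib,
    add_right_comm, ← sum_range_succ' a (4 * k + 1), sum_range_succ a, hlast, add_zero,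
    ← sum_add_distrib, sum_congr rfl fun q hq => hab q (Nat.lt_succ_iff.1 (mem_range.1 hq)),
    sum_range_succ' _ (4 * k), ← sum_neg_distrib]
  simp only [mul_zero, zero_mul, h0, add_zero]
  refine sum_congr rfl fun p hp => ?_
  rw [x_eq_y_sub k p (mem_range.1 hp)]
  ring

/-- The specialised matrix applied to a vector supported on `1, …, 16k²`. -/
theorem blockBidiagonal_mulVec_eq_zero (k n : ℕ) (hn : n + 1 = 4 * k) (w : ℕ → ℚ) (h0 : w 0 = 0)
    (hw : ∀ j, 16 * k ^ 2 < j → w j = 0)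
    (htop : ∑ p ∈ range (4 * k), x ℚ k (p + 1) (4 * k) * w (4 * (p + 1) * k) = 0)
    (hU : ∀ t < n, ∀ p < n + 2, uRow k w (4 * p * k + (t + 2)) = 0) :
    (blockBidiagonal n (fun i => x ℚ k (i + 1) (n + 1))
          (fun t i => f₁ k (fun _ => (N k : ℚ)) (fun _ => 1) (t + 1) (4 * i * k + (t + 1)))
          (fun t i => g₁ (fun _ => (N k : ℚ)) (fun _ => 1) (t + 1) (4 * i * k + (t + 1)))
          (fun t i => f₀ k (fun _ => (N k : ℚ)) (fun _ => 1) (t + 1) (4 * i * k + (t + 2)))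
          (fun t i => g₀ (fun _ => (N k : ℚ)) (fun _ => 1) (t + 1) (4 * i * k + (t + 2)))).mulVec
        (fun γ : BlockCol n => w (4 * γ.2 * k + (γ.1 + 1))) = 0 := by
  ext ρ
  rw [Matrix.mulVec, dotProduct, Fintype.sum_prod_type, Pi.zero_apply]
  rcases ρ with u | ⟨t, p⟩
  · simp only [blockBidiagonal]
    rw [sum_eq_single (Fin.last n)]
    · simp only [Fin.val_last, if_true]
      rw [Fin.sum_univ_eq_sum_range (fun i => x ℚ k (i + 1) (n + 1) * w (4 * i * k + (n + 1))), hn,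
        ← htop]
      refine sum_congr rfl fun i _ => ?_
      rw [show 4 * i * k + 4 * k = 4 * (i + 1) * k by ring]
    · intro s _ hs
      refine sum_eq_zero fun i _ => ?_
      rw [if_neg (show ¬ (s : ℕ) = n from fun h => hs (Fin.ext h)), zero_mul]
    · simp
  · have ht := t.2
    have hbig : ∀ s, 16 * k ^ 2 < 4 * (n + 1) * k + (s + 1) := by
      intro s
      rw [hn, show 4 * (4 * k) * k = 16 * k ^ 2 by ring]
      omega
    have key : ∀ (s : ℕ) (a b : ℕ → ℚ),
        ∑ i : Fin (n + 1), (if (p : ℕ) = i then a i else if (p : ℕ) = i + 1 then b i else 0)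
            * w (4 * i * k + (s + 1))
          = a p * w (4 * p * k + (s + 1))
            + if (p : ℕ) = 0 then 0 else b (p - 1) * w (4 * (p - 1 : ℕ) * k + (s + 1)) :=
      fun s a b => sum_bidiagonal_mul n p p.2 (fun i => w (4 * i * k + (s + 1)))
        (hw _ (hbig s)) a b
    simp only [blockBidiagonal]
    rw [sum_eq_add (⟨t, by omega⟩ : Fin (n + 1)) ⟨t + 1, by omega⟩]
    · have h1 : ¬ ((t : ℕ) + 1 = t) := by omega
      simp only [if_true, if_neg h1]
      rw [key t (fun i => f₁ k (fun _ => (N k : ℚ)) (fun _ => 1) (t + 1) (4 * i * k + (t + 1)))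
          fun i => g₁ (fun _ => (N k : ℚ)) (fun _ => 1) (t + 1) (4 * i * k + (t + 1)),
        key (t + 1)
          (fun i => f₀ k (fun _ => (N k : ℚ)) (fun _ => 1) (t + 1) (4 * i * k + (t + 2)))
          fun i => g₀ (fun _ => (N k : ℚ)) (fun _ => 1) (t + 1) (4 * i * k + (t + 2))]
      have h := hU t ht p p.2
      rw [uRow] at h
      by_cases hp : (p : ℕ) = 0
      · rw [if_pos hp, if_pos hp]
        rw [hp, show 4 * 0 * k + ((t : ℕ) + 2) - 4 * k = 0 by omega,
          show 4 * 0 * k + ((t : ℕ) + 2) - (4 * k + 1) = 0 by omega, h0,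
          show 4 * 0 * k + ((t : ℕ) + 2) - 1 = 4 * 0 * k + (t + 1) by omega] at h
        rw [hp]
        simp only [f₁, f₀]
        push_cast at h ⊢
        linear_combination h
      · obtain ⟨q, hq⟩ := Nat.exists_eq_succ_of_ne_zero hp
        rw [if_neg hp, if_neg hp]
        have e1 : 4 * (q + 1) * k + ((t : ℕ) + 2) - 4 * k = 4 * q * k + (t + 2) := by
          rw [show 4 * (q + 1) * k + ((t : ℕ) + 2) = 4 * q * k + (t + 2) + 4 * k by ring,
            Nat.add_sub_cancel]
        have e2 : 4 * (q + 1) * k + ((t : ℕ) + 2) - (4 * k + 1) = 4 * q * k + (t + 1) := by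
          rw [show 4 * (q + 1) * k + ((t : ℕ) + 2) = 4 * q * k + (t + 1) + (4 * k + 1) by ring,
            Nat.add_sub_cancel]
        have e3 : 4 * (q + 1) * k + ((t : ℕ) + 2) - 1 = 4 * (q + 1) * k + (t + 1) := rfl
        rw [hq, Nat.succ_eq_add_one, e1, e2, e3] at h
        rw [hq, Nat.succ_eq_add_one, Nat.add_sub_cancel]
        simp only [f₁, f₀, g₁, g₀]
        push_cast at h ⊢
        linear_combination h
    · intro h
      have := congrArg Fin.val h
      simp at this
    · intro s _ hs
      refine sum_eq_zero fun i _ => ?_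
      rw [if_neg fun h => hs.1 (Fin.ext h), if_neg fun h => hs.2 (Fin.ext h), zero_mul]
    · simp
    · simp

theorem uRow_zero (k i : ℕ) (w : ℕ → ℚ) (hw : ∀ j, w j = 0) : uRow k w i = 0 := by
  simp [uRow, hw]

theorem det_M_ne_zero (k : ℕ) (hk : 1 ≤ k) : (M k).det ≠ 0 := by
  intro hdet
  obtain ⟨v, hv0, hv⟩ := Matrix.exists_mulVec_eq_zero_iff.2 hdet
  apply hv0
  have hN : N k = 16 * k ^ 2 + 4 * k := by unfold N; ring
  have hNk : 4 * (4 * k + 1) * k = N k := by unfold N; ring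
  let w : ℕ → ℚ := fun j => if h : j - 1 < N k + 4 * k + 1 then v ⟨j - 1, h⟩ else 0
  have hvw : v = fun c : Fin (N k + 4 * k + 1) => w (c + 1) := by
    ext c
    have hc := c.2
    simp only [w, Nat.add_sub_cancel, dif_pos hc]
  set w' : ℕ → ℚ := fun j => if 1 ≤ j ∧ j < N k then w j else 0 with hw'
  have h0 : w' 0 = 0 := by simp [hw']
  rw [hvw] at hv
  have hpos : ∀ i, 1 ≤ i → i < N k + 4 * k + 1 → uRow k w' i
      + ∑ p ∈ range (4 * k + 2),
            (if i = 4 * p * k + 1 then ((-4 : ℚ) ^ (p * k))⁻¹ * w (N k + p) else 0) = 0 := by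
    intro i hi hi'
    have := congrFun hv ⟨i, hi'⟩
    rwa [M_mulVec_pos k hk w ⟨i, hi'⟩ (by simp; omega)] at this
  have hinj : ∀ p q, 4 * q * k + 1 = 4 * p * k + 1 → q = p := by
    intro p q h
    have : q * (4 * k) = p * (4 * k) := by linarith
    exact Nat.eq_of_mul_eq_mul_right (by omega) this
  -- Row 4qk+1 meets exactly one column of V, so it determines the corresponding coordinate.
  have hV : ∀ q < 4 * k + 2, w (N k + q) = -((-4) ^ k) ^ q * uRow k w' (4 * q * k + 1) := by
    intro q hq
    have hle : 4 * q * k ≤ N k := by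
      rw [← hNk]
      exact Nat.mul_le_mul_right k (by omega)
    have h := hpos (4 * q * k + 1) (by omega) (by omega)
    rw [sum_eq_single_of_mem q (mem_range.2 hq)
      fun p _ hp => if_neg fun h => hp (hinj p q h).symm, if_pos rfl, mul_comm q k, pow_mul] at h
    have hc : (((-4 : ℚ) ^ k) ^ q) ≠ 0 := by simp
    field_simp at h
    linear_combination h
  have hU : ∀ i, 1 ≤ i → i < N k + 4 * k + 1 → (∀ p < 4 * k + 2, i ≠ 4 * p * k + 1) →
      uRow k w' i = 0 := by
    intro i hi hi' hne
    have h := hpos i hi hi'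
    rwa [sum_eq_zero fun p hp => if_neg (hne p (mem_range.1 hp)), add_zero] at h
  have hlarge : ∀ j, N k ≤ j → w' j = 0 := fun j hj => by
    simp only [hw']; rw [if_neg (by omega)]
  -- Downward induction on j: row j+4k+1 lies below all rows met by V, its two upper coordinates are
  -- at least N(k), and j+1 is already known to vanish. The coefficient of w'(j) is nonzero because
  -- j < N(k).
  have htail : ∀ d j, j + d = N k → 16 * k ^ 2 < j → w' j = 0 := by
    intro d
    induction d with
    | zero => intro j hj _; exact hlarge j (by omega)
    | succ d ih =>
      intro j hj hjk
      have h := hU (j + 4 * k + 1) (by omega) (by omega) (by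
        intro p hp heq
        have hle : 4 * p * k ≤ N k := by
          rw [← hNk]
          exact Nat.mul_le_mul_right k (by omega)
        omega)
      rw [uRow, hlarge (j + 4 * k + 1) (by omega), hlarge (j + 4 * k + 1 - 1) (by omega),
        show j + 4 * k + 1 - 4 * k = j + 1 by omega, ih (j + 1) (by omega) (by omega),
        show j + 4 * k + 1 - (4 * k + 1) = j by omega] at h
      have hcoef : -(4 * (N k : ℚ) - 4 * (j : ℚ) - 2) ≠ 0 := by
        have : (N k : ℚ) = j + (d + 1) := by rw [← hj]; push_cast; ring
        rw [this]
        have : (0 : ℚ) ≤ d := Nat.cast_nonneg d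
        intro h
        linarith
      rw [mul_zero, mul_zero, mul_zero, zero_add, zero_add, zero_add] at h
      exact (mul_eq_zero.1 h).resolve_left hcoef
  have hw0 : ∀ j, 16 * k ^ 2 < j → w' j = 0 := by
    intro j hj
    by_cases hjN : N k ≤ j
    · exact hlarge j hjN
    · exact htail (N k - j) j (by omega) hj
  have htop : ∑ p ∈ range (4 * k), x ℚ k (p + 1) (4 * k) * w' (4 * (p + 1) * k) = 0 := by
    have h := congrFun hv ⟨0, by omega⟩
    rw [M_mulVec_top k hk w _ rfl, sum_congr rfl fun q hq => by rw [hV q (mem_range.1 hq)],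
      Pi.zero_apply] at h
    have h' := sum_y_mul_uRow k hk w' h0 hw0
    rw [← neg_eq_zero, ← h', ← neg_eq_zero, ← sum_neg_distrib, ← h]
    exact sum_congr rfl fun q _ => by ring
  obtain ⟨n, hn⟩ : ∃ n, n + 1 = 4 * k := ⟨4 * k - 1, by omega⟩
  have hq : (n + 1) * (n + 1) = 16 * k ^ 2 := by rw [hn]; ring
  -- The block rows are the rows 4pk+t+2 with t < 4k-1, none of them congruent to 1 modulo 4k, so V
  -- does not enter.
  have hB := blockBidiagonal_mulVec_eq_zero k n hn w' h0 hw0 htop (by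
    intro t ht p hp
    have hle : 4 * p * k ≤ N k := by
      rw [← hNk]
      exact Nat.mul_le_mul_right k (by omega)
    refine hU _ (by omega) (by omega) ?_
    intro q _ heq
    have h1 : (4 * k) * p + (t + 1) = (4 * k) * q := by linarith
    have h2 : (4 * k) ∣ t + 1 := (Nat.dvd_add_right (dvd_mul_right _ p)).1 ⟨q, h1⟩
    have := Nat.le_of_dvd (Nat.succ_pos t) h2
    omega)
  have hdetB := det_submatrix_matchRow n
    ((MXof k (fun _ => (N k : ℚ)) (fun _ => (N k : ℚ)) (fun _ => 1)).submatrix (finCongr hq)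
      (finCongr hq))
  rw [Matrix.det_submatrix_equiv_self, sign_matchPerm_eq k n hn,
    MXof_submatrix k n hn hq (by omega)] at hdetB
  have hne := mul_ne_zero (a := (((-1 : ℤˣ) : ℤ) : ℚ)) (by simp) (det_MXof_rat_ne_zero k hk)
  rw [← hdetB] at hne
  have hz : (fun γ : BlockCol n => w' (4 * γ.2 * k + (γ.1 + 1))) = 0 := by
    by_contra hz
    refine hne (Matrix.exists_mulVec_eq_zero_iff.1 ⟨_, hz, ?_⟩)
    ext γ
    exact congrFun hB (matchRow n γ)
  have hall : ∀ j, w' j = 0 := by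
    intro j
    rcases Nat.eq_zero_or_pos j with rfl | hj
    · exact h0
    by_cases hj' : 16 * k ^ 2 < j
    · exact hw0 j hj'
    · have h1 : (j - 1) / (n + 1) < n + 1 := Nat.div_lt_of_lt_mul (by omega)
      have h := congrFun hz (⟨(j - 1) % (n + 1), Nat.mod_lt _ (Nat.succ_pos n)⟩,
        ⟨(j - 1) / (n + 1), h1⟩)
      have h2 : 4 * ((j - 1) / (n + 1)) * k + ((j - 1) % (n + 1) + 1) = j := by
        have h3 := Nat.div_add_mod (j - 1) (n + 1)
        have h4 : 4 * ((j - 1) / (n + 1)) * k = (n + 1) * ((j - 1) / (n + 1)) := by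
          rw [hn]; ring
        omega
      simp only [h2] at h
      exact h
  ext c
  rw [hvw, Pi.zero_apply]
  have hc := c.2
  by_cases hcN : (c : ℕ) + 1 < N k
  · have h := hall (c + 1)
    simp only [hw'] at h
    rwa [if_pos ⟨by omega, hcN⟩] at h
  · have h := hV (c + 1 - N k) (by omega)
    rwa [show N k + ((c : ℕ) + 1 - N k) = c + 1 by omega, uRow_zero k _ w' hall, mul_zero] at h

end Nonsingular

end PiSeries

theorem theorem2 (k : ℕ) (hk : 1 ≤ k) :
    (PiSeries.MX k).det =
        (-1) ^ (k - 1) * 4 ^ (2 * k * (4 * k ^ 2 + 7 * k + 2))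
          * (k : MvPolynomial PiSeries.Var ℤ) ^ (2 * k * (4 * k + 1))
          * (∏ i ∈ Finset.Icc 1 (4 * k),
              ((i + 1).ascFactorial (4 * k - i + 1) : MvPolynomial PiSeries.Var ℤ))
          * (∏ a ∈ Finset.Icc 1 (4 * k - 1),
              (2 * PiSeries.X₁ a
                - (32 * (k : MvPolynomial PiSeries.Var ℤ) ^ 2
                    + 2 * (a : MvPolynomial PiSeries.Var ℤ) - 1) * PiSeries.Y a))
          * (∏ a ∈ Finset.Icc 1 (4 * k - 1), ∏ b ∈ Finset.Icc a (4 * k - 1),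
              (2 * PiSeries.X₂ b * PiSeries.Y a - 2 * PiSeries.X₁ a * PiSeries.Y b
                - (2 * (b : MvPolynomial PiSeries.Var ℤ)
                    - 2 * (a : MvPolynomial PiSeries.Var ℤ) + 1)
                  * PiSeries.Y a * PiSeries.Y b))
      ∧ ((PiSeries.MX k).map (MvPolynomial.eval (PiSeries.special k))).det ≠ 0
      ∧ (PiSeries.M k).det ≠ 0 := by
  refine ⟨?_, PiSeries.det_specialised_ne_zero k hk, PiSeries.det_M_ne_zero k hk⟩
  rw [PiSeries.det_MX k hk]
  simp only [PiSeries.linearFactor, PiSeries.resultantFactor]
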